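/- Let $\mu$ be a probability measure on $\mathbb R$ with finite moments. For $n\ge 1$ with $n\le |\operatorname{supp}\mu|$, the orthogonal polynomial ensemble of size $n$ associated with $\mu$ is the probability measure $\frac1{Z_n}\prod_{i>j}(\lambda_i-\lambda_j)^2\,d\mu(\lambda_1)\cdots d\mu(\lambda_n)$ on $\mathbb R^n$; $P$ and $\mathbb E$ refer to it. For measurable $f:\mathbb R\to\mathbb R$, $\alpha>0$ and $x^*\in\mathbb R$ put $X^{(n)}_{f,\alpha,x^*}=\sum_{j=1}^n f\big(n^\alpha(\lambda_j-x^*)\big)$, and let $\|f\|_\infty=\sup_{x\in\mathbb R}|f(x)|$. Let $\gamma_j>0$ denote the leading coefficient of the orthonormal polynomial of degree $j$ of $\mu$ (defined for $j<|\operatorname{supp}\mu|$). **I.** There is a universal constant $A>0$ such that for every probability measure $\mu$ with finite moments, every $x^*\in\mathbb R$, $\alpha>0$, every bounded measurable $f\not\equiv0$, every $\varepsilon>0$, every real $N\neq 0$ and every integer $n\ge1$ with $n\le|\operatorname{supp}\mu|$, $$P\left(\frac1N\left|X^{(n)}_{f,\alpha,x^*}-\mathbb E X^{(n)}_{f,\alpha,x^*}\right|\ge\varepsilon\right)\le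 2\exp\left(-\varepsilon\min\left(\frac{\varepsilon N^2}{8An\|f\|_\infty^2},\frac{N}{6\|f\|_\infty}\right)\right).$$ In particular, for $0<\alpha<1$ and $N=n^{1-\alpha}$, $$P\left(\frac1{n^{1-\alpha}}\left|X^{(n)}_{f,\alpha,x^*}-\mathbb E X^{(n)}_{f,\alpha,x^*}\right|\ge\varepsilon\right)\le 2\exp\left(-\varepsilon\min\left(\frac{\varepsilon n^{1-2\alpha}}{8A\|f\|_\infty^2},\frac{n^{1-\alpha}}{6\|f\|_\infty}\right)\right),$$ and the right-hand side of this last bound tends to $0$ as $n\to\infty$ if and only if $\alpha<\tfrac12$. **II.** Let $(\mu_n)$ be a sequence of probability measures on $\mathbb R$ with finite moments, such that $|\operatorname{supp}\mu_n|>n$ for all $n$, and let $\gamma_j^{(n)}$ be the coefficients $\gamma_j$ of $\mu_n$. Suppose that either all $\mu_n$ equal one compactly supported measure, or $\big(\gamma^{(n)}_{n-1}/\gamma^{(n)}_n\big)^2=O(1)$ as $n\to\infty$. Then there is a constant $A>0$, depending only on the sequence $(\mu_n)$, such that for every $x^*\in\mathbb R$, every $\alpha>0$, every bounded $f\not\equiv0$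 that is Lipschitz with constant $|f|_{\mathcal L}>0$, and every $\varepsilon>0$, the following holds for the ensembles of size $n$ associated with $\mu_n$: for every $n\ge1$, $$P\left(\frac1{n^{\alpha}}\left|X^{(n)}_{f,\alpha,x^*}-\mathbb E X^{(n)}_{f,\alpha,x^*}\right|\ge\varepsilon\right)\le 2\exp\left(-\varepsilon\min\left(\frac{\varepsilon}{2A|f|_{\mathcal L}^2},\frac{n^\alpha}{6\|f\|_\infty}\right)\right),$$ and for all sufficiently large $n$ (depending on $\varepsilon$, and on $\alpha$, $f$ and $x^*$), $$P\left(\frac1{n^{\alpha}}\left|X^{(n)}_{f,\alpha,x^*}-\mathbb E X^{(n)}_{f,\alpha,x^*}\right|\ge\varepsilon\right)\le 2\exp\left(-\frac{\varepsilon^2}{2A|f|_{\mathcal L}^2}\right).$$ -/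

import Mathlib

open MeasureTheory Filter Polynomial Asymptotics
open scoped Topology NNReal ENNReal

/-- All moments of `μ` are finite. -/
def HasFiniteMoments (μ : Measure ℝ) : Prop :=
  ∀ k : ℕ, Integrable (fun x : ℝ => x ^ k) μ

/-- The squared Vandermonde product `∏_{i > j} (x_i - x_j)²`. -/
def vandermondeSq (n : ℕ) (x : Fin n → ℝ) : ℝ :=
  ∏ i : Fin n, ∏ j ∈ Finset.Iio i, (x i - x j) ^ 2

/-- The normalizing constant `Z_n` of the orthogonal polynomial ensemble. -/
noncomputable def opeZ (μ : Measure ℝ) (n : ℕ) : ℝ≥0∞ :=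
  ∫⁻ x : Fin n → ℝ, ENNReal.ofReal (vandermondeSq n x) ∂(Measure.pi fun _ => μ)

/-- The orthogonal polynomial ensemble of size `n` associated with `μ`: the measure
`Z_n⁻¹ ∏_{i > j} (x_i - x_j)² dμ(x_1) ⋯ dμ(x_n)` on `ℝⁿ`. -/
noncomputable def ope (μ : Measure ℝ) (n : ℕ) : Measure (Fin n → ℝ) :=
  (opeZ μ n)⁻¹ •
    (Measure.pi fun _ => μ).withDensity (fun x => ENNReal.ofReal (vandermondeSq n x))

/-- The scaled linear statistic `∑_j f (n^α (x_j - x*))`. -/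
noncomputable def linStat (f : ℝ → ℝ) (α xs : ℝ) (n : ℕ) (x : Fin n → ℝ) : ℝ :=
  ∑ j : Fin n, f ((n : ℝ) ^ α * (x j - xs))

/-- The absolute deviation of the scaled linear statistic from its expectation under the
orthogonal polynomial ensemble. -/
noncomputable def linStatDev (μ : Measure ℝ) (f : ℝ → ℝ) (α xs : ℝ) (n : ℕ)
    (x : Fin n → ℝ) : ℝ :=
  |linStat f α xs n x - ∫ y, linStat f α xs n y ∂(ope μ n)|

/-- The supremum norm (used for bounded functions only). -/
noncomputable def realSupNorm (f : ℝ → ℝ) : ℝ := ⨆ x : ℝ, |f x|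

/-- The inner product of two real polynomials in `L²(μ)`. -/
noncomputable def polyInner (μ : Measure ℝ) (p q : ℝ[X]) : ℝ :=
  ∫ x, p.eval x * q.eval x ∂μ

/-- The monic orthogonal polynomials of `μ`, by the Gram-Schmidt process applied to
`1, x, x², …`. -/
noncomputable def monicOrthoPoly (μ : Measure ℝ) : ℕ → ℝ[X]
  | n => X ^ n - ∑ k : Fin n,
      C (polyInner μ (X ^ n) (monicOrthoPoly μ k) /
          polyInner μ (monicOrthoPoly μ k) (monicOrthoPoly μ k)) * monicOrthoPoly μ k
  decreasing_by exact k.2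

/-- The orthonormal polynomials `p_n` of `μ`, with positive leading coefficient (meaningful as
long as the support of `μ` has more than `n` points). -/
noncomputable def orthoPoly (μ : Measure ℝ) (n : ℕ) : ℝ[X] :=
  C (Real.sqrt (polyInner μ (monicOrthoPoly μ n) (monicOrthoPoly μ n)))⁻¹ * monicOrthoPoly μ n

/-- The leading coefficient `γ_n` of `p_n`. -/
noncomputable def orthoLead (μ : Measure ℝ) (n : ℕ) : ℝ := (orthoPoly μ n).leadingCoeff

/-! The engine is a variance bound that survives exponential tilting. For a bounded variable `X`,
the second derivative of its cumulant generating function at `u` is the variance of `X` under the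
law tilted by `exp (u X)`. Bounding these variances by `2V` for `|u| ≤ s` gives a Gaussian bound on
the centred moment generating function, and Chernoff's inequality does the rest
(`measureReal_abs_ge_le_of_variance_tilted_le`). When `X` is a linear statistic of an orthogonal
polynomial ensemble, the tilted law is again such an ensemble, for `exp (u f) dμ` normalized
(`HasFiniteMoments.ope_tilted`). So only variances of linear statistics need bounding, provided the
bounds are stable under changing the measure.

The variance is controlled by the defect: the total squared distance of the functions `f p_k`, `k <
n`, from the span of `p_0, …, p_{n-1}` (`HasFiniteMoments.variance_ope_le`). For bounded `f` it is
at most `n ‖f‖²`, whatever the measure; this gives Part I.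

For Lipschitz `f`, twice the defect is the integral of `(f x - f y)² K(x,y)²`, with `K` the
reproducing kernel, so `f` may be compared with the identity (`mulDefect_le_of_abs_sub_le`).
Multiplication by `x` leaves the polynomials of degree `< n` only through the top one, so its defect
is at most `(γ_{n-1}/γ_n)²` (`HasFiniteMoments.mulDefect_id_le`). The scaling by `n^α` enters
through the Lipschitz constant and cancels against the normalization. The ratio for the tilted
measure is within a factor `exp (2|u|‖f‖)` of the original, because monic orthogonal polynomials
minimize the norm (`HasFiniteMoments.orthoNormSq_ratio_tilted_le`); this factor is at most `2` when
`|u| ≤ 1/(3‖f‖)`, whence the second term in the minimum. -/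

/-! ### Deviation bounds from variances under exponential tilts -/

section Chernoff

open ProbabilityTheory

variable {Ω : Type*} [MeasurableSpace Ω]

lemma integrable_exp_mul_of_abs_le {P : Measure Ω} [IsFiniteMeasure P] {X : Ω → ℝ}
    (hX : Measurable X) {C : ℝ} (hC : ∀ ω, |X ω| ≤ C) (t : ℝ) :
    Integrable (fun ω => Real.exp (t * X ω)) P :=
  integrable_exp_mul_of_mem_Icc (a := -C) (b := C) hX.aemeasurable
    (ae_of_all _ fun ω => abs_le.mp (hC ω))

lemma tilted_add_const {P : Measure Ω} (f : Ω → ℝ) (c : ℝ) :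
    P.tilted (fun ω => f ω + c) = P.tilted f := by
  unfold Measure.tilted
  congr 1
  funext ω
  simp_rw [Real.exp_add, integral_mul_const]
  rw [mul_div_mul_right _ _ (Real.exp_pos c).ne']

/-- The cumulant generating function of the centred variable vanishes to first order at `0`, so
Taylor's formula leaves `t²/2` times its second derivative at some `u` in between, which is a tilted
variance. Centring changes neither the tilt nor the variance. -/
lemma mgf_centered_le_of_variance_tilted_le {P : Measure Ω} [IsProbabilityMeasure P] {X : Ω → ℝ}
    (hX : Measurable X) {C : ℝ} (hC : ∀ ω, |X ω| ≤ C) {V t : ℝ} (ht : 0 < t)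
    (hV : ∀ u, 0 < u → u ≤ t → Var[X; P.tilted fun ω => u * X ω] ≤ 2 * V) :
    mgf (fun ω => X ω - ∫ ω, X ω ∂P) P t ≤ Real.exp (V * t ^ 2) := by
  set m := ∫ ω, X ω ∂P with hm
  have hXi : Integrable X P :=
    Integrable.of_bound hX.aestronglyMeasurable C (ae_of_all _ hC)
  have hY : Measurable fun ω => X ω - m := hX.sub_const m
  have hYC : ∀ ω, |X ω - m| ≤ C + |m| := fun ω =>
    (abs_sub _ _).trans (add_le_add_left (hC ω) _)
  have hint : ∀ s, Integrable (fun ω => Real.exp (s * (X ω - m))) P :=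
    integrable_exp_mul_of_abs_le hY hYC
  have huniv : integrableExpSet (fun ω => X ω - m) P = Set.univ :=
    Set.eq_univ_of_forall hint
  have hc : ∫ ω, (X ω - m) ∂P = 0 := by
    rw [integral_sub hXi (integrable_const _)]
    simp [hm]
  have hs : Set.Icc 0 t ⊆ interior (integrableExpSet (fun ω => X ω - m) P) := by
    simp [huniv]
  obtain ⟨u, hu, heq⟩ := exists_cgf_eq_iteratedDeriv_two_cgf_mul ht hc hs
  rw [← exp_cgf (hint t), Real.exp_le_exp, heq,
    ← variance_tilted_mul (hs ⟨hu.1.le, hu.2.le⟩)]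
  have h1 : (fun ω => u * (X ω - m)) = fun ω => u * X ω + -(u * m) := by
    funext ω; ring
  have : IsProbabilityMeasure (P.tilted fun ω => u * X ω) :=
    isProbabilityMeasure_tilted (integrable_exp_mul_of_abs_le hX hC u)
  rw [h1, tilted_add_const, variance_sub_const hX.aestronglyMeasurable]
  nlinarith [hV u hu.1 hu.2.le, sq_nonneg t]

lemma measureReal_ge_le_of_variance_tilted_le {P : Measure Ω} [IsProbabilityMeasure P]
    {X : Ω → ℝ} (hX : Measurable X) {C : ℝ} (hC : ∀ ω, |X ω| ≤ C) {V s δ : ℝ} (hV0 : 0 < V)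
    (hs : 0 < s) (hδ : 0 < δ)
    (hV : ∀ u, |u| ≤ s → Var[X; P.tilted fun ω => u * X ω] ≤ 2 * V) :
    P.real {ω | δ ≤ X ω - ∫ ω, X ω ∂P} ≤
      Real.exp (-min (δ ^ 2 / (4 * V)) (δ * s / 2)) := by
  set m := ∫ ω, X ω ∂P with hm
  -- The minimizer `δ / (2V)` of `V t² - δ t`, truncated to the range where the variance is
  -- controlled.
  set t := min (δ / (2 * V)) s with htdef
  have ht : 0 < t := lt_min (by positivity) hs
  have hYC : ∀ ω, |X ω - m| ≤ C + |m| := fun ω =>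
    (abs_sub _ _).trans (add_le_add_left (hC ω) _)
  have h1 := measure_ge_le_exp_mul_mgf (μ := P) (X := fun ω => X ω - m) δ ht.le
    (integrable_exp_mul_of_abs_le (hX.sub_const m) hYC t)
  have h2 := mgf_centered_le_of_variance_tilted_le hX hC ht
    (fun u hu hut => hV u (by rw [abs_of_pos hu]; exact hut.trans (min_le_right _ _)))
  have h3 : V * t ≤ δ / 2 := by
    have : t ≤ δ / (2 * V) := min_le_left _ _
    rw [le_div_iff₀ (by positivity)] at this
    linarith
  have h4 : min (δ ^ 2 / (4 * V)) (δ * s / 2) = δ / 2 * t := by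
    rw [htdef, mul_min_of_nonneg _ _ (by positivity)]
    congr 1
    · field_simp; norm_num
    · ring
  calc P.real {ω | δ ≤ X ω - m} ≤ Real.exp (-t * δ) * mgf (fun ω => X ω - m) P t := h1
    _ ≤ Real.exp (-t * δ) * Real.exp (V * t ^ 2) := by gcongr
    _ = Real.exp (-t * δ + V * t ^ 2) := (Real.exp_add _ _).symm
    _ ≤ _ := by
      rw [Real.exp_le_exp, h4]
      nlinarith

/-- A Bernstein-type deviation bound for a bounded random variable whose variance stays bounded
under small exponential tilts. -/
lemma measureReal_abs_ge_le_of_variance_tilted_le {P : Measure Ω} [IsProbabilityMeasure P]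
    {X : Ω → ℝ} (hX : Measurable X) {C : ℝ} (hC : ∀ ω, |X ω| ≤ C) {V s δ : ℝ} (hV0 : 0 < V)
    (hs : 0 < s) (hδ : 0 < δ)
    (hV : ∀ u, |u| ≤ s → Var[X; P.tilted fun ω => u * X ω] ≤ 2 * V) :
    P.real {ω | δ ≤ |X ω - ∫ ω, X ω ∂P|} ≤
      2 * Real.exp (-min (δ ^ 2 / (4 * V)) (δ * s / 2)) := by
  have h1 := measureReal_ge_le_of_variance_tilted_le hX hC hV0 hs hδ hV
  have h2 := measureReal_ge_le_of_variance_tilted_le (X := fun ω => - X ω) hX.neg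
    (C := C) (by simpa using hC) hV0 hs hδ (fun u hu => by
      have e : (fun ω => u * -X ω) = fun ω => (-u) * X ω := by funext ω; ring
      rw [e, variance_fun_neg]
      exact hV (-u) (by simpa using hu))
  rw [integral_neg] at h2
  have hsub : {ω | δ ≤ |X ω - ∫ ω, X ω ∂P|} ⊆
      {ω | δ ≤ X ω - ∫ ω, X ω ∂P} ∪ {ω | δ ≤ -X ω - -∫ ω, X ω ∂P} := by
    intro ω hω
    rcases le_abs.mp (show δ ≤ |X ω - ∫ ω, X ω ∂P| from hω) with h | h
    · exact Or.inl h
    · right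
      show δ ≤ -X ω - -∫ ω, X ω ∂P
      linarith
  calc _ ≤ P.real ({ω | δ ≤ X ω - ∫ ω, X ω ∂P} ∪ {ω | δ ≤ -X ω - -∫ ω, X ω ∂P}) :=
        measureReal_mono hsub
    _ ≤ _ := measureReal_union_le _ _
    _ ≤ _ := by linarith

end Chernoff

lemma memLp_two_integrable_mul {Ω : Type*} [MeasurableSpace Ω] {P : Measure Ω} {f g : Ω → ℝ}
    (hf : MemLp f 2 P) (hg : MemLp g 2 P) : Integrable (fun x => f x * g x) P :=
  hf.integrable_mul hg

/-! ### Slater determinants and the second moment of a linear statistic -/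

section Slater

open Matrix Equiv

variable {n : ℕ}

/-- The matrix `(g_i(x_j))` of a family of functions evaluated at a family of points. -/
def slaterMatrix (g : Fin n → ℝ → ℝ) (x : Fin n → ℝ) : Matrix (Fin n) (Fin n) ℝ :=
  Matrix.of fun i j => g i (x j)

lemma slater_mul_expand (g h : Fin n → ℝ → ℝ) (x : Fin n → ℝ) :
    (slaterMatrix g x).det * (slaterMatrix h x).det =
      ∑ σ : Perm (Fin n), ∑ τ : Perm (Fin n), ((Perm.sign σ : ℤ) : ℝ) * ((Perm.sign τ : ℤ) : ℝ) *
        ∏ j, g (σ j) (x j) * h (τ j) (x j) := by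
  rw [det_apply', det_apply', Finset.sum_mul_sum]
  refine Finset.sum_congr rfl fun σ _ => Finset.sum_congr rfl fun τ _ => ?_
  simp only [slaterMatrix, of_apply, Finset.prod_mul_distrib]
  ring

variable {μ : Measure ℝ} [SigmaFinite μ]

lemma integrable_slater_mul {g h : Fin n → ℝ → ℝ}
    (hgh : ∀ i j, Integrable (fun x => g i x * h j x) μ) :
    Integrable (fun x => (slaterMatrix g x).det * (slaterMatrix h x).det)
      (Measure.pi fun _ : Fin n => μ) := by
  simp_rw [slater_mul_expand]
  refine integrable_finsetSum _ fun σ _ => integrable_finsetSum _ fun τ _ => ?_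
  exact (Integrable.fintype_prod (f := fun j x => g (σ j) x * h (τ j) x)
    fun j => hgh _ _).const_mul _

/-- Andréief's identity. -/
lemma integral_slater_mul {g h : Fin n → ℝ → ℝ}
    (hgh : ∀ i j, Integrable (fun x => g i x * h j x) μ) :
    ∫ x, (slaterMatrix g x).det * (slaterMatrix h x).det ∂(Measure.pi fun _ : Fin n => μ) =
      n.factorial * (Matrix.of fun i j => ∫ x, g i x * h j x ∂μ).det := by
  have hi : ∀ σ τ : Perm (Fin n), Integrable (fun x : Fin n → ℝ =>
      ((Perm.sign σ : ℤ) : ℝ) * ((Perm.sign τ : ℤ) : ℝ) *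
        ∏ j, g (σ j) (x j) * h (τ j) (x j)) (Measure.pi fun _ => μ) := fun σ τ =>
    (Integrable.fintype_prod (f := fun j x => g (σ j) x * h (τ j) x)
      fun j => hgh _ _).const_mul _
  simp_rw [slater_mul_expand]
  rw [integral_finsetSum _ fun σ _ => integrable_finsetSum _ fun τ _ => hi σ τ]
  set G : Matrix (Fin n) (Fin n) ℝ := Matrix.of fun i j => ∫ x, g i x * h j x ∂μ with hG
  -- For fixed `σ` the sum over `τ` is the determinant of the Gram matrix with rows permuted by `σ`;
  -- the sign this produces cancels the sign of `σ`, so every `σ` contributes equally.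
  have key : ∀ σ : Perm (Fin n), ∫ x : Fin n → ℝ, ∑ τ : Perm (Fin n),
      ((Perm.sign σ : ℤ) : ℝ) * ((Perm.sign τ : ℤ) : ℝ) *
        ∏ j, g (σ j) (x j) * h (τ j) (x j) ∂(Measure.pi fun _ => μ) = G.det := by
    intro σ
    rw [integral_finsetSum _ fun τ _ => hi σ τ]
    have h1 : ∀ τ : Perm (Fin n), ∫ x : Fin n → ℝ,
        ((Perm.sign σ : ℤ) : ℝ) * ((Perm.sign τ : ℤ) : ℝ) *
          ∏ j, g (σ j) (x j) * h (τ j) (x j) ∂(Measure.pi fun _ => μ) =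
        ((Perm.sign σ : ℤ) : ℝ) * (((Perm.sign τ : ℤ) : ℝ) *
          ∏ j, (G.submatrix σ id)ᵀ (τ j) j) := by
      intro τ
      rw [integral_const_mul,
        integral_fintype_prod_eq_prod (f := fun j x => g (σ j) x * h (τ j) x), mul_assoc]
      rfl
    simp_rw [h1]
    rw [← Finset.mul_sum, ← det_apply', det_transpose, det_permute, ← mul_assoc, ← Int.cast_mul,
      Int.units_coe_mul_self]
    simp
  rw [Finset.sum_congr rfl fun σ _ => key σ]
  simp [Fintype.card_perm]

/-- In the Leibniz expansion each permutation meets row `k` in the single column `σ⁻¹ k`, so scaling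
that row by `d` yields the factor `d (σ⁻¹ k)`; summing over `k` gives the sum of `d` for every `σ`.
-/
lemma sum_mul_det_eq_sum_det_updateRow (M : Matrix (Fin n) (Fin n) ℝ) (d : Fin n → ℝ) :
    (∑ j, d j) * M.det = ∑ k, (M.updateRow k fun j => d j * M k j).det := by
  have key : ∀ (k : Fin n) (σ : Perm (Fin n)),
      ∏ j, (M.updateRow k fun j => d j * M k j) (σ j) j = d (σ⁻¹ k) * ∏ j, M (σ j) j := by
    intro k σ
    have h1 : ∀ j, (M.updateRow k fun j => d j * M k j) (σ j) j =
        (if σ⁻¹ k = j then d j else 1) * M (σ j) j := by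
      intro j
      by_cases h : σ j = k
      · have h' : σ⁻¹ k = j := by rw [← h]; simp
        rw [h, updateRow_self, if_pos h']
      · have h' : σ⁻¹ k ≠ j := fun h' => h (by rw [← h']; simp)
        rw [updateRow_ne h, if_neg h', one_mul]
    simp_rw [h1, Finset.prod_mul_distrib]
    congr 1
    simp
  simp_rw [det_apply', key]
  rw [Finset.sum_comm, Finset.mul_sum]
  refine Finset.sum_congr rfl fun σ _ => ?_
  have h2 : ∑ k, d (σ⁻¹ k) = ∑ k, d k := Equiv.sum_comp σ⁻¹ d
  rw [← h2, Finset.sum_mul]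
  exact Finset.sum_congr rfl fun k _ => by ring

lemma slaterMatrix_update (g : Fin n → ℝ → ℝ) (k : Fin n) (u : ℝ → ℝ) (x : Fin n → ℝ) :
    slaterMatrix (Function.update g k u) x =
      (slaterMatrix g x).updateRow k fun j => u (x j) := by
  ext i j
  by_cases h : i = k
  · subst h; simp [slaterMatrix]
  · simp [slaterMatrix, h, updateRow_ne]

/-- The matrix entries `⟨f e_k, e_j⟩` of multiplication by `f`. -/
noncomputable def mulEntry (μ : Measure ℝ) (f : ℝ → ℝ) (e : Fin n → ℝ → ℝ) (k j : Fin n) : ℝ :=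
  ∫ x, f x * e k x * e j x ∂μ

/-- The component of `f e_k` orthogonal to the span of the `e_j`. -/
noncomputable def mulResidual (μ : Measure ℝ) (f : ℝ → ℝ) (e : Fin n → ℝ → ℝ) (k : Fin n) :
    ℝ → ℝ :=
  fun x => f x * e k x - ∑ j, mulEntry μ f e k j * e j x

/-- The squared norms of the residuals of `f e_k`. -/
noncomputable def mulDefect (μ : Measure ℝ) (f : ℝ → ℝ) (e : Fin n → ℝ → ℝ) : ℝ :=
  ∑ k, ∫ x, mulResidual μ f e k x ^ 2 ∂μ

/-- Multiplication by a linear statistic acts on a Slater determinant as a derivation, replacing one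
`e k` at a time by `f * e k`. Among the components of `f * e k` along the `e j`, those with `j ≠ k`
repeat a row, and `j = k` produces the trace being subtracted; only the residual remains. -/
lemma linear_statistic_mul_slater (μ : Measure ℝ) (f : ℝ → ℝ) (e : Fin n → ℝ → ℝ)
    (x : Fin n → ℝ) :
    (∑ j, f (x j) - ∑ k, mulEntry μ f e k k) * (slaterMatrix e x).det =
      ∑ k, (slaterMatrix (Function.update e k (mulResidual μ f e k)) x).det := by
  rw [sub_mul, sum_mul_det_eq_sum_det_updateRow, Finset.sum_mul, ← Finset.sum_sub_distrib]
  refine Finset.sum_congr rfl fun k _ => ?_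
  have h1 : (fun j => f (x j) * slaterMatrix e x k j) =
      (fun j => mulResidual μ f e k (x j)) +
        ∑ i, mulEntry μ f e k i • (slaterMatrix e x) i := by
    funext j
    simp [mulResidual, slaterMatrix, Finset.sum_apply]
  rw [h1, det_updateRow_add, det_updateRow_sum, slaterMatrix_update]
  simp

section Orthonormal

variable {e : Fin n → ℝ → ℝ} {f : ℝ → ℝ} (he : ∀ i, MemLp (e i) 2 μ)
  (ho : ∀ i j, ∫ x, e i x * e j x ∂μ = if i = j then 1 else 0)
  (hf : ∀ i, MemLp (fun x => f x * e i x) 2 μ)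

include he hf in
omit [SigmaFinite μ] in
lemma memLp_mulResidual (k : Fin n) : MemLp (mulResidual μ f e k) 2 μ :=
  (hf k).sub (memLp_finsetSum _ fun j _ => (he j).const_mul _)

include he ho hf in
omit [SigmaFinite μ] in
lemma integral_mul_mulResidual (i k : Fin n) : ∫ x, e i x * mulResidual μ f e k x ∂μ = 0 := by
  have h1 : ∀ x, e i x * mulResidual μ f e k x =
      f x * e k x * e i x - ∑ j, mulEntry μ f e k j * (e i x * e j x) := by
    intro x
    rw [mulResidual, mul_sub, Finset.mul_sum]
    congr 1
    · ring
    · exact Finset.sum_congr rfl fun j _ => by ring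
  have hi : ∀ j, Integrable (fun x => mulEntry μ f e k j * (e i x * e j x)) μ := fun j =>
    ((he i).integrable_mul (he j)).const_mul _
  simp_rw [h1]
  rw [integral_sub (memLp_two_integrable_mul (hf k) (he i)) (integrable_finsetSum _ fun j _ => hi j),
    integral_finsetSum _ fun j _ => hi j]
  simp_rw [integral_const_mul, ho]
  simp [mulEntry]

include he ho hf in
-- The determinants with one row replaced by its residual are mutually orthogonal by Andréief's
-- identity, so the square of their sum integrates to the sum of their squared norms.
lemma integral_linear_statistic_mul_slater_sq :
    Integrable (fun x : Fin n → ℝ => (∑ j, f (x j) - ∑ k, mulEntry μ f e k k) ^ 2 *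
      (slaterMatrix e x).det ^ 2) (Measure.pi fun _ => μ) ∧
    ∫ x : Fin n → ℝ, (∑ j, f (x j) - ∑ k, mulEntry μ f e k k) ^ 2 *
      (slaterMatrix e x).det ^ 2 ∂(Measure.pi fun _ => μ) = n.factorial * mulDefect μ f e := by
  set r : Fin n → Fin n → ℝ → ℝ := fun k => Function.update e k (mulResidual μ f e k) with hr
  have hrm : ∀ k i, MemLp (r k i) 2 μ := by
    intro k i
    by_cases h : i = k
    · subst h; simpa [hr] using memLp_mulResidual he hf i
    · simpa [hr, h] using he i
  have hrr : ∀ k l i j, Integrable (fun x => r k i x * r l j x) μ := fun k l i j =>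
    (hrm k i).integrable_mul (hrm l j)
  have h1 : ∀ x : Fin n → ℝ, (∑ j, f (x j) - ∑ k, mulEntry μ f e k k) ^ 2 *
      (slaterMatrix e x).det ^ 2 =
      ∑ k, ∑ l, (slaterMatrix (r k) x).det * (slaterMatrix (r l) x).det := by
    intro x
    rw [← mul_pow, linear_statistic_mul_slater, sq, Finset.sum_mul_sum]
  have hi : ∀ k l, Integrable (fun x : Fin n → ℝ =>
      (slaterMatrix (r k) x).det * (slaterMatrix (r l) x).det) (Measure.pi fun _ => μ) :=
    fun k l => integrable_slater_mul (hrr k l)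
  simp_rw [h1]
  refine ⟨integrable_finsetSum _ fun k _ => integrable_finsetSum _ fun l _ => hi k l, ?_⟩
  rw [integral_finsetSum _ fun k _ => integrable_finsetSum _ fun l _ => hi k l, mulDefect,
    Finset.mul_sum]
  refine Finset.sum_congr rfl fun k _ => ?_
  rw [integral_finsetSum _ fun l _ => hi k l, Finset.sum_eq_single k]
  · rw [integral_slater_mul (hrr k k)]
    congr 1
    -- Replacing `e k` by its residual keeps the family orthogonal; only the `k`-th squared norm
    -- changes.
    have h2 : (Matrix.of fun i j => ∫ x, r k i x * r k j x ∂μ) = Matrix.diagonal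
        (Function.update 1 k (∫ x, mulResidual μ f e k x ^ 2 ∂μ)) := by
      ext i j
      by_cases hi : i = k <;> by_cases hj : j = k
      · subst hi; subst hj
        simp [hr, sq]
      · subst hi
        rw [diagonal_apply_ne _ (Ne.symm hj)]
        simp only [hr, of_apply, Function.update_self, Function.update_of_ne hj]
        simp_rw [mul_comm (mulResidual μ f e i _)]
        exact integral_mul_mulResidual he ho hf j i
      · subst hj
        rw [diagonal_apply_ne _ hi]
        simp only [hr, of_apply, Function.update_self, Function.update_of_ne hi]
        exact integral_mul_mulResidual he ho hf i j
      · simp only [hr, of_apply, Function.update_of_ne hj, Function.update_of_ne hi, ho]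
        by_cases hij : i = j
        · subst hij; simp [hi]
        · simp [hij]
    rw [h2, det_diagonal, Finset.prod_update_of_mem (Finset.mem_univ k)]
    simp
  · intro l _ hlk
    -- For `l ≠ k` the first family still contains `e l`, while the second has it replaced by
    -- something orthogonal to it, so row `l` of the mixed Gram matrix vanishes.
    rw [integral_slater_mul (hrr k l), det_eq_zero_of_row_eq_zero l, mul_zero]
    intro j
    by_cases hj : j = l
    · subst hj
      simp only [hr, of_apply, Function.update_self, Function.update_of_ne hlk]
      exact integral_mul_mulResidual he ho hf j j
    · simp only [hr, of_apply, Function.update_of_ne hlk, Function.update_of_ne hj, ho]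
      rw [if_neg (Ne.symm hj)]
  · simp

include he ho in
lemma integral_slater_sq :
    ∫ x : Fin n → ℝ, (slaterMatrix e x).det ^ 2 ∂(Measure.pi fun _ => μ) = n.factorial := by
  simp_rw [sq]
  rw [integral_slater_mul fun i j => (he i).integrable_mul (he j)]
  have h2 : (Matrix.of fun i j => ∫ x, e i x * e j x ∂μ) = 1 := by
    ext i j
    simp [ho, one_apply]
  rw [h2, det_one, mul_one]

include he ho hf in
omit [SigmaFinite μ] in
/-- The residual has minimal norm modulo the span of the `e_j`. -/
lemma integral_mulResidual_sq_le (k : Fin n) (c : Fin n → ℝ) :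
    ∫ x, mulResidual μ f e k x ^ 2 ∂μ ≤ ∫ x, (f x * e k x - ∑ j, c j * e j x) ^ 2 ∂μ := by
  set v : ℝ → ℝ := fun x => ∑ j, (mulEntry μ f e k j - c j) * e j x with hv
  have hvm : MemLp v 2 μ := memLp_finsetSum _ fun j _ => (he j).const_mul _
  have hq := memLp_mulResidual he hf k
  have h1 : ∀ x, (f x * e k x - ∑ j, c j * e j x) ^ 2 =
      mulResidual μ f e k x ^ 2 + (2 * (v x * mulResidual μ f e k x) + v x ^ 2) := by
    intro x
    have : f x * e k x - ∑ j, c j * e j x = mulResidual μ f e k x + v x := by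
      simp only [mulResidual, hv, sub_mul, Finset.sum_sub_distrib]
      ring
    rw [this]; ring
  have h2 : ∫ x, v x * mulResidual μ f e k x ∂μ = 0 := by
    simp only [hv, Finset.sum_mul, mul_assoc]
    rw [integral_finsetSum _ fun j _ => ((memLp_two_integrable_mul (he j) hq).const_mul _)]
    simp_rw [integral_const_mul, integral_mul_mulResidual he ho hf]
    simp
  have i1 : Integrable (fun x => 2 * (v x * mulResidual μ f e k x)) μ :=
    (memLp_two_integrable_mul hvm hq).const_mul 2
  have i2 : Integrable (fun x => 2 * (v x * mulResidual μ f e k x) + v x ^ 2) μ :=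
    i1.add hvm.integrable_sq
  simp_rw [h1]
  rw [integral_add hq.integrable_sq i2, integral_add i1 hvm.integrable_sq, integral_const_mul, h2]
  have : 0 ≤ ∫ x, v x ^ 2 ∂μ := integral_nonneg fun x => sq_nonneg _
  linarith

include he ho hf in
omit [SigmaFinite μ] in
lemma mulDefect_le_sum_integral_sq : mulDefect μ f e ≤ ∑ k, ∫ x, (f x * e k x) ^ 2 ∂μ := by
  refine Finset.sum_le_sum fun k _ => ?_
  simpa using integral_mulResidual_sq_le he ho hf k 0

include he ho hf in
omit [SigmaFinite μ] in
lemma integral_mulResidual_sq (k : Fin n) :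
    ∫ x, mulResidual μ f e k x ^ 2 ∂μ =
      ∫ x, (f x * e k x) ^ 2 ∂μ - ∑ j, mulEntry μ f e k j ^ 2 := by
  have hq := memLp_mulResidual he hf k
  have h1 : ∀ x, mulResidual μ f e k x ^ 2 = f x * e k x * (f x * e k x) -
      ∑ j, mulEntry μ f e k j * (f x * e k x * e j x) -
      ∑ j, mulEntry μ f e k j * (e j x * mulResidual μ f e k x) := by
    intro x
    have h2 : ∑ j, mulEntry μ f e k j * (f x * e k x * e j x) =
        f x * e k x * ∑ j, mulEntry μ f e k j * e j x := by
      rw [Finset.mul_sum]; exact Finset.sum_congr rfl fun j _ => by ring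
    have h3 : ∑ j, mulEntry μ f e k j * (e j x * mulResidual μ f e k x) =
        mulResidual μ f e k x * ∑ j, mulEntry μ f e k j * e j x := by
      rw [Finset.mul_sum]; exact Finset.sum_congr rfl fun j _ => by ring
    rw [h2, h3, mulResidual]; ring
  have i2 : ∀ j, Integrable (fun x => mulEntry μ f e k j * (f x * e k x * e j x)) μ :=
    fun j => ((hf k).integrable_mul (he j)).const_mul _
  have i3 : ∀ j, Integrable (fun x => mulEntry μ f e k j * (e j x * mulResidual μ f e k x)) μ :=
    fun j => ((he j).integrable_mul hq).const_mul _
  have i1 : Integrable (fun x => f x * e k x * (f x * e k x)) μ := (hf k).integrable_mul (hf k)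
  have i4 : Integrable (fun x => f x * e k x * (f x * e k x) -
      ∑ j, mulEntry μ f e k j * (f x * e k x * e j x)) μ :=
    i1.sub (integrable_finsetSum _ fun j _ => i2 j)
  simp_rw [h1]
  rw [integral_sub i4
    (integrable_finsetSum _ fun j _ => i3 j),
    integral_sub i1 (integrable_finsetSum _ fun j _ => i2 j),
    integral_finsetSum _ fun j _ => i2 j, integral_finsetSum _ fun j _ => i3 j]
  simp_rw [integral_const_mul, integral_mul_mulResidual he ho hf, mul_zero,
    Finset.sum_const_zero, sub_zero, sq]
  rfl

include he ho hf in
/-- The defect as a double integral against the squared reproducing kernel. -/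
lemma integral_prod_sq_diff_mul_kernel_sq :
    Integrable (fun z : ℝ × ℝ => (f z.1 - f z.2) ^ 2 * (∑ k, e k z.1 * e k z.2) ^ 2) (μ.prod μ) ∧
    ∫ z : ℝ × ℝ, (f z.1 - f z.2) ^ 2 * (∑ k, e k z.1 * e k z.2) ^ 2 ∂(μ.prod μ) =
      2 * mulDefect μ f e := by
  have h1 : ∀ z : ℝ × ℝ, (f z.1 - f z.2) ^ 2 * (∑ k, e k z.1 * e k z.2) ^ 2 =
      ∑ k, ∑ l, ((f z.1 * e k z.1 * (f z.1 * e l z.1)) * (e k z.2 * e l z.2) -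
        2 * ((f z.1 * e k z.1 * e l z.1) * (f z.2 * e k z.2 * e l z.2)) +
        (e k z.1 * e l z.1) * (f z.2 * e k z.2 * (f z.2 * e l z.2))) := by
    intro z
    rw [sq (∑ k, _), Finset.sum_mul_sum, Finset.mul_sum]
    refine Finset.sum_congr rfl fun k _ => ?_
    rw [Finset.mul_sum]
    exact Finset.sum_congr rfl fun l _ => by ring
  have a1 : ∀ k l, Integrable (fun x => e k x * e l x) μ := fun k l =>
    (he k).integrable_mul (he l)
  have a2 : ∀ k l, Integrable (fun x => f x * e k x * e l x) μ := fun k l =>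
    (hf k).integrable_mul (he l)
  have a3 : ∀ k l, Integrable (fun x => f x * e k x * (f x * e l x)) μ := fun k l =>
    (hf k).integrable_mul (hf l)
  have i1 : ∀ k l, Integrable (fun z : ℝ × ℝ =>
      (f z.1 * e k z.1 * (f z.1 * e l z.1)) * (e k z.2 * e l z.2)) (μ.prod μ) := fun k l =>
    (a3 k l).mul_prod (a1 k l)
  have i2 : ∀ k l, Integrable (fun z : ℝ × ℝ =>
      2 * ((f z.1 * e k z.1 * e l z.1) * (f z.2 * e k z.2 * e l z.2))) (μ.prod μ) := fun k l =>
    ((a2 k l).mul_prod (a2 k l)).const_mul 2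
  have i3 : ∀ k l, Integrable (fun z : ℝ × ℝ =>
      (e k z.1 * e l z.1) * (f z.2 * e k z.2 * (f z.2 * e l z.2))) (μ.prod μ) := fun k l =>
    (a1 k l).mul_prod (a3 k l)
  have i12 : ∀ k l, Integrable (fun z : ℝ × ℝ =>
      (f z.1 * e k z.1 * (f z.1 * e l z.1)) * (e k z.2 * e l z.2) -
        2 * ((f z.1 * e k z.1 * e l z.1) * (f z.2 * e k z.2 * e l z.2))) (μ.prod μ) :=
    fun k l => (i1 k l).sub (i2 k l)
  have i4 : ∀ k l, Integrable (fun z : ℝ × ℝ =>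
      (f z.1 * e k z.1 * (f z.1 * e l z.1)) * (e k z.2 * e l z.2) -
        2 * ((f z.1 * e k z.1 * e l z.1) * (f z.2 * e k z.2 * e l z.2)) +
        (e k z.1 * e l z.1) * (f z.2 * e k z.2 * (f z.2 * e l z.2))) (μ.prod μ) :=
    fun k l => (i12 k l).add (i3 k l)
  simp_rw [h1]
  refine ⟨integrable_finsetSum _ fun k _ => integrable_finsetSum _ fun l _ => i4 k l, ?_⟩
  rw [integral_finsetSum _ fun k _ => integrable_finsetSum _ fun l _ => i4 k l, mulDefect,
    Finset.mul_sum]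
  refine Finset.sum_congr rfl fun k _ => ?_
  rw [integral_finsetSum _ fun l _ => i4 k l, integral_mulResidual_sq he ho hf]
  have h2 : ∀ l, ∫ z : ℝ × ℝ, ((f z.1 * e k z.1 * (f z.1 * e l z.1)) * (e k z.2 * e l z.2) -
        2 * ((f z.1 * e k z.1 * e l z.1) * (f z.2 * e k z.2 * e l z.2)) +
        (e k z.1 * e l z.1) * (f z.2 * e k z.2 * (f z.2 * e l z.2))) ∂(μ.prod μ) =
      (if k = l then 2 * ∫ x, f x * e k x * (f x * e l x) ∂μ else 0) -
        2 * mulEntry μ f e k l ^ 2 := by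
    intro l
    rw [integral_add (i12 k l) (i3 k l), integral_sub (i1 k l) (i2 k l),
      integral_const_mul,
      integral_prod_mul (fun x => f x * e k x * (f x * e l x)) (fun x => e k x * e l x),
      integral_prod_mul (fun x => f x * e k x * e l x) (fun x => f x * e k x * e l x),
      integral_prod_mul (fun x => e k x * e l x) (fun x => f x * e k x * (f x * e l x)), ho,
      mulEntry]
    split_ifs <;> ring
  simp_rw [h2]
  rw [Finset.sum_sub_distrib, Finset.sum_ite_eq, if_pos (Finset.mem_univ k), ← Finset.mul_sum,
    mul_sub]
  simp_rw [sq]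

include he ho hf in
-- The kernel weight in the double-integral formula is nonnegative and independent of the
-- multiplier, so a pointwise comparison of increments suffices.
lemma mulDefect_le_of_abs_sub_le {g : ℝ → ℝ} (hg : ∀ i, MemLp (fun x => g x * e i x) 2 μ)
    {L : ℝ} (hL : ∀ x y, |f x - f y| ≤ L * |g x - g y|) :
    mulDefect μ f e ≤ L ^ 2 * mulDefect μ g e := by
  obtain ⟨h1, h2⟩ := integral_prod_sq_diff_mul_kernel_sq he ho hf
  obtain ⟨h3, h4⟩ := integral_prod_sq_diff_mul_kernel_sq he ho hg
  have : 2 * mulDefect μ f e ≤ L ^ 2 * (2 * mulDefect μ g e) := by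
    rw [← h2, ← h4, ← integral_const_mul]
    refine integral_mono h1 (h3.const_mul _) fun z => ?_
    have := pow_le_pow_left₀ (abs_nonneg _) (hL z.1 z.2) 2
    rw [sq_abs, mul_pow, sq_abs] at this
    show _ ≤ L ^ 2 * (_ * _)
    rw [← mul_assoc]
    gcongr
  linarith

end Orthonormal

end Slater

/-! ### Orthogonal polynomials, their extremal property, and the defect of multiplication by `x` -/

section OrthogonalPolynomials

lemma degree_C_mul_le_degree (c : ℝ) (p : ℝ[X]) : (C c * p).degree ≤ p.degree := by
  refine (degree_mul_le _ _).trans ?_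
  simpa using add_le_add_left (degree_C_le (a := c)) p.degree

variable {μ : Measure ℝ}

lemma HasFiniteMoments.integrable_eval (hμ : HasFiniteMoments μ) (p : ℝ[X]) :
    Integrable (fun x => p.eval x) μ := by
  simp_rw [eval_eq_sum, Polynomial.sum]
  exact integrable_finsetSum _ fun i _ => (hμ i).const_mul _

lemma HasFiniteMoments.integrable_eval_mul (hμ : HasFiniteMoments μ) (p q : ℝ[X]) :
    Integrable (fun x => p.eval x * q.eval x) μ := by
  simpa using hμ.integrable_eval (p * q)

lemma HasFiniteMoments.memLp_eval (hμ : HasFiniteMoments μ) (p : ℝ[X]) :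
    MemLp (fun x => p.eval x) 2 μ := by
  refine (memLp_two_iff_integrable_sq p.continuous.aestronglyMeasurable).2 ?_
  exact (hμ.integrable_eval (p ^ 2)).congr (ae_of_all _ fun x => eval_pow 2)

lemma polyInner_comm (p q : ℝ[X]) : polyInner μ p q = polyInner μ q p := by
  simp only [polyInner, mul_comm]

lemma polyInner_C_mul_left (c : ℝ) (p q : ℝ[X]) :
    polyInner μ (C c * p) q = c * polyInner μ p q := by
  simp only [polyInner, eval_mul, eval_C, mul_assoc, integral_const_mul]

lemma HasFiniteMoments.polyInner_add_left (hμ : HasFiniteMoments μ) (p q r : ℝ[X]) :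
    polyInner μ (p + q) r = polyInner μ p r + polyInner μ q r := by
  simp only [polyInner, eval_add, add_mul]
  exact integral_add (hμ.integrable_eval_mul p r) (hμ.integrable_eval_mul q r)

lemma HasFiniteMoments.polyInner_sub_left (hμ : HasFiniteMoments μ) (p q r : ℝ[X]) :
    polyInner μ (p - q) r = polyInner μ p r - polyInner μ q r := by
  simp only [polyInner, eval_sub, sub_mul]
  exact integral_sub (hμ.integrable_eval_mul p r) (hμ.integrable_eval_mul q r)

lemma HasFiniteMoments.polyInner_sum_left (hμ : HasFiniteMoments μ) {ι : Type*} (s : Finset ι)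
    (p : ι → ℝ[X]) (r : ℝ[X]) :
    polyInner μ (∑ i ∈ s, p i) r = ∑ i ∈ s, polyInner μ (p i) r := by
  simp only [polyInner, eval_finsetSum, Finset.sum_mul]
  exact integral_finsetSum _ fun i _ => hμ.integrable_eval_mul (p i) r

lemma polyInner_self_nonneg (p : ℝ[X]) : 0 ≤ polyInner μ p p :=
  integral_nonneg fun _ => mul_self_nonneg _

/-- If the norm vanished, the closed zero set of `p` would carry `μ`, hence contain its support,
which has more points than `p` has roots. -/
lemma HasFiniteMoments.polyInner_self_pos (hμ : HasFiniteMoments μ) {p : ℝ[X]} (hp : p ≠ 0)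
    (hd : (p.natDegree : ℕ∞) < μ.support.encard) : 0 < polyInner μ p p := by
  refine (polyInner_self_nonneg p).lt_of_ne' fun h0 => ?_
  have h1 : (fun x => p.eval x * p.eval x) =ᵐ[μ] 0 :=
    (integral_eq_zero_iff_of_nonneg (fun _ => mul_self_nonneg _)
      (hμ.integrable_eval_mul p p)).1 h0
  have h2 : μ.support ⊆ {x | p.eval x = 0} := by
    refine Measure.support_subset_of_isClosed (isClosed_eq p.continuous continuous_const) ?_
    filter_upwards [h1] with x hx
    exact mul_self_eq_zero.1 hx
  have h3 : {x | p.eval x = 0} = (p.roots.toFinset : Set ℝ) := by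
    ext x; simp [hp]
  have h4 : μ.support.encard ≤ p.natDegree := by
    refine (Set.encard_le_encard h2).trans ?_
    rw [h3, Set.encard_coe_eq_coe_finsetCard]
    exact_mod_cast (Multiset.toFinset_card_le _).trans (card_roots' p)
  exact absurd hd (not_lt.2 h4)

lemma degree_monicOrthoPoly_sub_lt (μ : Measure ℝ) (n : ℕ) :
    (monicOrthoPoly μ n - X ^ n).degree < (n : WithBot ℕ) := by
  induction n using Nat.strong_induction_on with
  | _ n ih =>
    rw [monicOrthoPoly, sub_sub_cancel_left, degree_neg]
    refine (degree_sum_le _ _).trans_lt ((Finset.sup_lt_iff (WithBot.bot_lt_coe n)).2 ?_)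
    intro k _
    have hk : (monicOrthoPoly μ k).degree ≤ (k : ℕ) := by
      have h := degree_add_le (monicOrthoPoly μ k - X ^ (k : ℕ)) (X ^ (k : ℕ))
      rw [sub_add_cancel, degree_X_pow] at h
      exact h.trans (max_le (ih k k.2).le le_rfl)
    refine (degree_mul_le _ _).trans_lt ?_
    refine (add_le_add degree_C_le hk).trans_lt ?_
    rw [zero_add]
    exact Nat.cast_lt.2 k.2

lemma monicOrthoPoly_eq_add (μ : Measure ℝ) (n : ℕ) :
    monicOrthoPoly μ n = X ^ n + (monicOrthoPoly μ n - X ^ n) := by ring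

lemma monic_monicOrthoPoly (μ : Measure ℝ) (n : ℕ) : (monicOrthoPoly μ n).Monic := by
  rw [monicOrthoPoly_eq_add]
  exact monic_X_pow_add (degree_monicOrthoPoly_sub_lt μ n)

lemma natDegree_monicOrthoPoly (μ : Measure ℝ) (n : ℕ) :
    (monicOrthoPoly μ n).natDegree = n := by
  rw [monicOrthoPoly_eq_add]
  refine natDegree_eq_of_degree_eq_some ?_
  rw [degree_add_eq_left_of_degree_lt, degree_X_pow]
  rw [degree_X_pow]
  exact degree_monicOrthoPoly_sub_lt μ n

/-- The squared norm of the monic orthogonal polynomial of degree `n`. -/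
noncomputable def orthoNormSq (μ : Measure ℝ) (n : ℕ) : ℝ :=
  polyInner μ (monicOrthoPoly μ n) (monicOrthoPoly μ n)

lemma HasFiniteMoments.orthoNormSq_pos (hμ : HasFiniteMoments μ) {n : ℕ}
    (hn : (n : ℕ∞) < μ.support.encard) : 0 < orthoNormSq μ n :=
  hμ.polyInner_self_pos (monic_monicOrthoPoly μ n).ne_zero (by rwa [natDegree_monicOrthoPoly])

/-- Degree `m` equal to the size of the support is allowed, since Gram-Schmidt divides only by the
norms of lower degree. -/
lemma HasFiniteMoments.polyInner_monicOrthoPoly_of_lt (hμ : HasFiniteMoments μ) {m : ℕ}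
    (hm : (m : ℕ∞) ≤ μ.support.encard) {j : ℕ} (hj : j < m) :
    polyInner μ (monicOrthoPoly μ m) (monicOrthoPoly μ j) = 0 := by
  induction m using Nat.strong_induction_on generalizing j with
  | _ m ih =>
    have hlt : ∀ k, k < m → (k : ℕ∞) < μ.support.encard := fun k hk =>
      (Nat.cast_lt.2 hk).trans_le hm
    rw [monicOrthoPoly, hμ.polyInner_sub_left, hμ.polyInner_sum_left,
      Finset.sum_eq_single (⟨j, hj⟩ : Fin m)]
    · have h := (hμ.orthoNormSq_pos (hlt j hj)).ne'
      rw [orthoNormSq] at h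
      rw [polyInner_C_mul_left, div_mul_cancel₀ _ h, sub_self]
    · intro k _ hkj
      rw [polyInner_C_mul_left]
      have hkj' : (k : ℕ) ≠ j := fun h => hkj (Fin.ext h)
      rcases lt_or_gt_of_ne hkj' with h | h
      · rw [polyInner_comm (monicOrthoPoly μ k) (monicOrthoPoly μ j),
          ih j hj (hlt j hj).le h, mul_zero]
      · rw [ih k k.2 (hlt k k.2).le h, mul_zero]
    · simp

lemma exists_eq_sum_monicOrthoPoly (μ : Measure ℝ) (n : ℕ) {q : ℝ[X]} (hq : q.degree < n) :
    ∃ c : ℕ → ℝ, q = ∑ j ∈ Finset.range n, C (c j) * monicOrthoPoly μ j := by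
  induction n generalizing q with
  | zero =>
    refine ⟨0, ?_⟩
    simpa using hq
  | succ n ih =>
    have h1 : (q - C (q.coeff n) * monicOrthoPoly μ n).degree < n := by
      rw [degree_lt_iff_coeff_zero]
      intro m hm
      rw [coeff_sub, coeff_C_mul]
      rcases hm.eq_or_lt with rfl | hm
      · have : (monicOrthoPoly μ n).coeff n = 1 := by
          simpa [Monic, leadingCoeff, natDegree_monicOrthoPoly] using monic_monicOrthoPoly μ n
        rw [this]; ring
      · rw [(degree_lt_iff_coeff_zero _ _).1 hq m hm,
          coeff_eq_zero_of_natDegree_lt (p := monicOrthoPoly μ n)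
            (by rwa [natDegree_monicOrthoPoly])]
        ring
    obtain ⟨c, hc⟩ := ih h1
    refine ⟨Function.update c n (q.coeff n), ?_⟩
    rw [Finset.sum_range_succ, Function.update_self]
    have h2 : ∑ j ∈ Finset.range n, C (Function.update c n (q.coeff n) j) * monicOrthoPoly μ j =
        ∑ j ∈ Finset.range n, C (c j) * monicOrthoPoly μ j := by
      refine Finset.sum_congr rfl fun j hj => ?_
      rw [Function.update_of_ne (Finset.mem_range.1 hj).ne]
    rw [h2, ← hc]
    ring

/-- The monic orthogonal polynomial has minimal norm among monic polynomials of its degree. -/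
lemma HasFiniteMoments.orthoNormSq_le (hμ : HasFiniteMoments μ) {n : ℕ}
    (hn : (n : ℕ∞) ≤ μ.support.encard) {q : ℝ[X]} (hq : q.Monic) (hqn : q.natDegree = n) :
    orthoNormSq μ n ≤ polyInner μ q q := by
  set r := q - monicOrthoPoly μ n with hr
  have hdeg : r.degree < n := by
    have h1 : q.degree = (n : ℕ) := by rw [degree_eq_natDegree hq.ne_zero, hqn]
    have h2 : (monicOrthoPoly μ n).degree = (n : ℕ) := by
      rw [degree_eq_natDegree (monic_monicOrthoPoly μ n).ne_zero, natDegree_monicOrthoPoly]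
    rw [← h1]
    exact degree_sub_lt_left (h1.trans h2.symm) hq.ne_zero
      (by rw [hq.leadingCoeff, (monic_monicOrthoPoly μ n).leadingCoeff])
  obtain ⟨c, hc⟩ := exists_eq_sum_monicOrthoPoly μ n hdeg
  have h0 : polyInner μ r (monicOrthoPoly μ n) = 0 := by
    rw [hc, hμ.polyInner_sum_left]
    refine Finset.sum_eq_zero fun j hj => ?_
    rw [polyInner_C_mul_left, polyInner_comm,
      hμ.polyInner_monicOrthoPoly_of_lt hn (Finset.mem_range.1 hj), mul_zero]
  have hq' : q = r + monicOrthoPoly μ n := by rw [hr]; ring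
  have h1 : polyInner μ q q = polyInner μ r r + orthoNormSq μ n := by
    rw [hq', hμ.polyInner_add_left, polyInner_comm r (r + _),
      polyInner_comm (monicOrthoPoly μ n) (r + _), hμ.polyInner_add_left, hμ.polyInner_add_left,
      polyInner_comm (monicOrthoPoly μ n) r, h0, orthoNormSq]
    ring
  linarith [polyInner_self_nonneg (μ := μ) r]

lemma orthoLead_eq (μ : Measure ℝ) (n : ℕ) : orthoLead μ n = (Real.sqrt (orthoNormSq μ n))⁻¹ := by
  rw [orthoLead, orthoPoly, leadingCoeff_mul, leadingCoeff_C,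
    (monic_monicOrthoPoly μ n).leadingCoeff, mul_one, orthoNormSq]

lemma HasFiniteMoments.orthoLead_div_sq (hμ : HasFiniteMoments μ) {n : ℕ}
    (hn : (n : ℕ∞) < μ.support.encard) :
    (orthoLead μ (n - 1) / orthoLead μ n) ^ 2 = orthoNormSq μ n / orthoNormSq μ (n - 1) := by
  have h1 := hμ.orthoNormSq_pos hn
  have h2 : 0 < orthoNormSq μ (n - 1) :=
    hμ.orthoNormSq_pos ((Nat.cast_le.2 (Nat.sub_le n 1)).trans_lt hn)
  rw [orthoLead_eq, orthoLead_eq, div_pow, inv_pow, inv_pow, Real.sq_sqrt h1.le,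
    Real.sq_sqrt h2.le]
  field_simp

/-- The first `n` orthonormal polynomials, as functions. -/
noncomputable def orthoFun (μ : Measure ℝ) (n : ℕ) (i : Fin n) (x : ℝ) : ℝ :=
  (orthoPoly μ i).eval x

lemma HasFiniteMoments.memLp_orthoFun (hμ : HasFiniteMoments μ) (n : ℕ) (i : Fin n) :
    MemLp (orthoFun μ n i) 2 μ := hμ.memLp_eval _

lemma HasFiniteMoments.integral_orthoFun_mul (hμ : HasFiniteMoments μ) {n : ℕ}
    (hn : (n : ℕ∞) ≤ μ.support.encard) (i j : Fin n) :
    ∫ x, orthoFun μ n i x * orthoFun μ n j x ∂μ = if i = j then 1 else 0 := by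
  have hlt : ∀ k : Fin n, (k : ℕ∞) < μ.support.encard := fun k =>
    (Nat.cast_lt.2 k.2).trans_le hn
  have h1 : ∫ x, orthoFun μ n i x * orthoFun μ n j x ∂μ =
      (Real.sqrt (orthoNormSq μ i))⁻¹ * ((Real.sqrt (orthoNormSq μ j))⁻¹ *
        polyInner μ (monicOrthoPoly μ i) (monicOrthoPoly μ j)) := by
    change polyInner μ (orthoPoly μ i) (orthoPoly μ j) = _
    rw [orthoPoly, orthoPoly, polyInner_C_mul_left, polyInner_comm _ (C _ * _),
      polyInner_C_mul_left, polyInner_comm (monicOrthoPoly μ j) (monicOrthoPoly μ i)]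
    rfl
  rw [h1]
  split_ifs with h
  · subst h
    change _ * (_ * orthoNormSq μ i) = 1
    have hp := hμ.orthoNormSq_pos (hlt i)
    have hs := Real.sqrt_pos.2 hp
    rw [← mul_assoc, ← mul_inv, Real.mul_self_sqrt hp.le, inv_mul_cancel₀ hp.ne']
  · have h' : (i : ℕ) ≠ j := fun h' => h (Fin.ext h')
    rcases lt_or_gt_of_ne h' with h' | h'
    · rw [polyInner_comm, hμ.polyInner_monicOrthoPoly_of_lt (hlt j).le h']; simp
    · rw [hμ.polyInner_monicOrthoPoly_of_lt (hlt i).le h']; simp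

lemma HasFiniteMoments.exists_eval_eq_sum_orthoFun (hμ : HasFiniteMoments μ) {n : ℕ}
    (hn : (n : ℕ∞) ≤ μ.support.encard) {q : ℝ[X]} (hq : q.degree < n) :
    ∃ c : Fin n → ℝ, ∀ x, q.eval x = ∑ j, c j * orthoFun μ n j x := by
  obtain ⟨c, hc⟩ := exists_eq_sum_monicOrthoPoly μ n hq
  refine ⟨fun j => c j * Real.sqrt (orthoNormSq μ j), fun x => ?_⟩
  rw [hc, eval_finsetSum, Finset.sum_range]
  refine Finset.sum_congr rfl fun j _ => ?_
  have hs := Real.sqrt_pos.2 (hμ.orthoNormSq_pos ((Nat.cast_lt.2 j.2).trans_le hn))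
  rw [orthoFun, orthoPoly, eval_mul, eval_mul, eval_C, eval_C]
  change _ = _ * ((Real.sqrt (orthoNormSq μ j))⁻¹ * _)
  field_simp

/-- Multiplication by `x` maps the polynomials of degree less than `n` into themselves up to one
dimension. -/
lemma HasFiniteMoments.mulDefect_id_le (hμ : HasFiniteMoments μ) {n : ℕ} (hn1 : 1 ≤ n)
    (hn : (n : ℕ∞) ≤ μ.support.encard) :
    mulDefect μ (fun x => x) (orthoFun μ n) ≤ orthoNormSq μ n / orthoNormSq μ (n - 1) := by
  have he := hμ.memLp_orthoFun n
  have ho := hμ.integral_orthoFun_mul hn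
  have hf : ∀ i, MemLp (fun x => x * orthoFun μ n i x) 2 μ := fun i =>
    (hμ.memLp_eval (X * orthoPoly μ i)).congr_norm
      (measurable_id.mul (orthoPoly μ i).continuous.measurable).aestronglyMeasurable
      (ae_of_all _ fun x => by simp [orthoFun])
  obtain ⟨m, rfl⟩ : ∃ m, n = m + 1 := ⟨n - 1, by omega⟩
  rw [Nat.add_sub_cancel, mulDefect, Fin.sum_univ_castSucc]
  -- Below the top index, `x p_k` still has degree at most `m`, so it lies in the span and leaves no
  -- residual.
  have h1 : ∀ k : Fin m, ∫ x, mulResidual μ (fun x => x) (orthoFun μ (m + 1)) k.castSucc x ^ 2 ∂μ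
      ≤ 0 := by
    intro k
    have hd : (X * orthoPoly μ k).degree < ((m + 1 : ℕ) : WithBot ℕ) := by
      refine (degree_mul_le _ _).trans_lt ?_
      have h2 : (orthoPoly μ k).degree ≤ (k : ℕ) := by
        refine (degree_C_mul_le_degree _ _).trans ?_
        rw [degree_eq_natDegree (monic_monicOrthoPoly μ k).ne_zero, natDegree_monicOrthoPoly]
      rw [degree_X]
      refine (add_le_add le_rfl h2).trans_lt ?_
      have := k.2
      exact_mod_cast (by omega : 1 + (k : ℕ) < m + 1)
    obtain ⟨c, hc⟩ := hμ.exists_eval_eq_sum_orthoFun hn hd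
    have h3 := integral_mulResidual_sq_le he ho hf k.castSucc c
    have h4 : ∀ x, x * orthoFun μ (m + 1) k.castSucc x = ∑ j, c j * orthoFun μ (m + 1) j x :=
      fun x => by rw [← hc]; simp [orthoFun]
    simpa [h4] using h3
  have h5 : ∫ x, mulResidual μ (fun x => x) (orthoFun μ (m + 1)) (Fin.last m) x ^ 2 ∂μ ≤
      orthoNormSq μ (m + 1) / orthoNormSq μ m := by
    have hm : 0 < orthoNormSq μ m :=
      hμ.orthoNormSq_pos ((Nat.cast_lt.2 m.lt_succ_self).trans_le hn)
    set s := (Real.sqrt (orthoNormSq μ m))⁻¹ with hs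
    -- At the top index, this element of the span is used as a competitor for `x p_m`: the
    -- difference is `s` times the monic orthogonal polynomial of degree `m + 1`.
    have hd : (C s * (X * monicOrthoPoly μ m - monicOrthoPoly μ (m + 1))).degree <
        ((m + 1 : ℕ) : WithBot ℕ) := by
      refine (degree_C_mul_le_degree _ _).trans_lt ?_
      have hX : (X * monicOrthoPoly μ m).Monic := monic_X.mul (monic_monicOrthoPoly μ m)
      have hXd : (X * monicOrthoPoly μ m).natDegree = m + 1 := by
        rw [natDegree_X_mul (monic_monicOrthoPoly μ m).ne_zero, natDegree_monicOrthoPoly]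
      have h1 : (X * monicOrthoPoly μ m).degree = ((m + 1 : ℕ) : WithBot ℕ) := by
        rw [degree_eq_natDegree hX.ne_zero, hXd]
      have h2 : (monicOrthoPoly μ (m + 1)).degree = ((m + 1 : ℕ) : WithBot ℕ) := by
        rw [degree_eq_natDegree (monic_monicOrthoPoly μ _).ne_zero, natDegree_monicOrthoPoly]
      rw [← h1]
      exact degree_sub_lt_left (h1.trans h2.symm) hX.ne_zero
        (by rw [hX.leadingCoeff, (monic_monicOrthoPoly μ _).leadingCoeff])
    obtain ⟨c, hc⟩ := hμ.exists_eval_eq_sum_orthoFun hn hd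
    refine (integral_mulResidual_sq_le he ho hf (Fin.last m) c).trans_eq ?_
    have h4 : ∀ x, (x * orthoFun μ (m + 1) (Fin.last m) x -
        ∑ j, c j * orthoFun μ (m + 1) j x) ^ 2 = (orthoNormSq μ m)⁻¹ *
        ((monicOrthoPoly μ (m + 1)).eval x * (monicOrthoPoly μ (m + 1)).eval x) := by
      intro x
      have hs2 : s ^ 2 = (orthoNormSq μ m)⁻¹ := by rw [hs, inv_pow, Real.sq_sqrt hm.le]
      have h6 : orthoFun μ (m + 1) (Fin.last m) x = s * (monicOrthoPoly μ m).eval x := by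
        simp [orthoFun, orthoPoly, hs, orthoNormSq]
      rw [← hc, h6, ← hs2]
      simp only [eval_mul, eval_C, eval_sub, eval_X]
      ring
    simp_rw [h4]
    rw [integral_const_mul, div_eq_inv_mul]
    rfl
  have h7 := Finset.sum_nonpos fun k (_ : k ∈ Finset.univ) => h1 k
  linarith

/-- Passing from powers to monic polynomials is unitriangular and keeps the Vandermonde determinant;
normalizing the rows then extracts the norms. -/
lemma vandermondeSq_eq (μ : Measure ℝ) {n : ℕ} (hn : ∀ i < n, 0 < orthoNormSq μ i)
    (x : Fin n → ℝ) :
    vandermondeSq n x =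
      (∏ i : Fin n, orthoNormSq μ i) * (slaterMatrix (orthoFun μ n) x).det ^ 2 := by
  have h1 : vandermondeSq n x = (Matrix.vandermonde x).det ^ 2 := by
    rw [Matrix.det_vandermonde, vandermondeSq, ← Finset.prod_pow]
    simp_rw [← Finset.prod_pow]
    exact Finset.prod_comm' (by simp)
  have h2 : (Matrix.vandermonde x).det =
      (slaterMatrix (fun i : Fin n => (monicOrthoPoly μ i).eval) x).det := by
    rw [Matrix.det_eval_matrixOfPolynomials_eq_det_vandermonde x
      (fun i : Fin n => monicOrthoPoly μ i) (fun i => natDegree_monicOrthoPoly μ i)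
      (fun i => monic_monicOrthoPoly μ i), ← Matrix.det_transpose]
    rfl
  have h3 : (slaterMatrix (orthoFun μ n) x).det = (∏ i : Fin n, (Real.sqrt (orthoNormSq μ i))⁻¹) *
      (slaterMatrix (fun i : Fin n => (monicOrthoPoly μ i).eval) x).det := by
    rw [← Matrix.det_mul_column]
    congr 1
    ext i j
    simp [slaterMatrix, orthoFun, orthoPoly, orthoNormSq]
  rw [h1, h2, h3, mul_pow, ← mul_assoc, ← Finset.prod_pow, ← Finset.prod_mul_distrib]
  rw [Finset.prod_eq_one, one_mul]
  intro i _
  rw [inv_pow, Real.sq_sqrt (hn i i.2).le, mul_inv_cancel₀ (hn i i.2).ne']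

end OrthogonalPolynomials

/-! ### The ensemble as a squared Slater determinant, and variance bounds -/

section Ensemble

open ProbabilityTheory

lemma pi_withDensity_const {α ι : Type*} [Fintype ι] [MeasurableSpace α] {μ : Measure α}
    [IsProbabilityMeasure μ] {w : α → ℝ≥0∞} (hw : Measurable w)
    [SigmaFinite (μ.withDensity w)] :
    Measure.pi (fun _ : ι => μ.withDensity w) =
      (Measure.pi fun _ : ι => μ).withDensity fun x => ∏ i, w (x i) := by
  refine Measure.pi_eq (fun s hs => ?_)
  have hX : ∀ i, Measurable ((s i).indicator w) := fun i => hw.indicator (hs i)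
  rw [withDensity_apply _ (MeasurableSet.univ_pi hs),
    ← lintegral_indicator (MeasurableSet.univ_pi hs)]
  have h1 : ∀ x : ι → α, (Set.univ.pi s).indicator (fun x => ∏ i, w (x i)) x =
      ∏ i, (s i).indicator w (x i) := by
    intro x
    by_cases hx : x ∈ Set.univ.pi s
    · rw [Set.indicator_of_mem hx]
      exact Finset.prod_congr rfl fun i _ =>
        (Set.indicator_of_mem (hx i (Set.mem_univ i)) _).symm
    · rw [Set.indicator_of_notMem hx]
      have : ∃ i, x i ∉ s i := by
        by_contra! h
        exact hx fun i _ => h i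
      obtain ⟨i, hi⟩ := this
      exact (Finset.prod_eq_zero (Finset.mem_univ i) (Set.indicator_of_notMem hi _)).symm
  simp_rw [h1]
  rw [lintegral_prod_eq_prod_lintegral_of_indepFun Finset.univ
    (fun i (x : ι → α) => (s i).indicator w (x i))
    (iIndepFun_pi fun i => (hX i).aemeasurable)
    (fun i => (hX i).comp (measurable_pi_apply i))]
  refine Finset.prod_congr rfl fun i _ => ?_
  rw [(measurePreserving_eval (fun _ : ι => μ) i).lintegral_comp (hX i),
    lintegral_indicator (hs i), withDensity_apply _ (hs i)]

/-- Allows two ensembles to be identified from their unnormalized densities, without comparing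
normalizing constants. -/
lemma smul_eq_smul_of_isProbabilityMeasure {Ω : Type*} [MeasurableSpace Ω] {κ : Measure Ω}
    {a b : ℝ≥0∞} (ha : IsProbabilityMeasure (a • κ)) (hb : IsProbabilityMeasure (b • κ)) :
    a • κ = b • κ := by
  have h1 : a * κ Set.univ = 1 := by
    rw [← ha.measure_univ, Measure.smul_apply, smul_eq_mul]
  have h2 : b * κ Set.univ = 1 := by
    rw [← hb.measure_univ, Measure.smul_apply, smul_eq_mul]
  rw [ENNReal.eq_inv_of_mul_eq_one_left h1, ENNReal.eq_inv_of_mul_eq_one_left h2]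

lemma continuous_vandermondeSq (n : ℕ) : Continuous (vandermondeSq n) := by
  unfold vandermondeSq
  fun_prop

lemma vandermondeSq_nonneg (n : ℕ) (x : Fin n → ℝ) : 0 ≤ vandermondeSq n x :=
  Finset.prod_nonneg fun _ _ => Finset.prod_nonneg fun _ _ => sq_nonneg _

lemma measurable_ofReal_vandermondeSq (n : ℕ) :
    Measurable fun x : Fin n → ℝ => ENNReal.ofReal (vandermondeSq n x) :=
  (continuous_vandermondeSq n).measurable.ennreal_ofReal

variable {μ : Measure ℝ} [IsProbabilityMeasure μ]

omit [IsProbabilityMeasure μ] in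
lemma HasFiniteMoments.orthoNormSq_pos_of_lt (hμ : HasFiniteMoments μ) {n : ℕ}
    (hn : (n : ℕ∞) ≤ μ.support.encard) (i : ℕ) (hi : i < n) : 0 < orthoNormSq μ i :=
  hμ.orthoNormSq_pos ((Nat.cast_lt.2 hi).trans_le hn)

lemma HasFiniteMoments.opeZ_eq (hμ : HasFiniteMoments μ) {n : ℕ}
    (hn : (n : ℕ∞) ≤ μ.support.encard) :
    opeZ μ n = ENNReal.ofReal ((∏ i : Fin n, orthoNormSq μ i) * n.factorial) := by
  have he := hμ.memLp_orthoFun n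
  have hi : Integrable (fun x : Fin n → ℝ => (∏ i : Fin n, orthoNormSq μ i) *
      (slaterMatrix (orthoFun μ n) x).det ^ 2) (Measure.pi fun _ => μ) := by
    simp_rw [sq]
    exact (integrable_slater_mul fun i j => memLp_two_integrable_mul (he i) (he j)).const_mul _
  have h1 := vandermondeSq_eq μ (hμ.orthoNormSq_pos_of_lt hn)
  rw [opeZ, ← ofReal_integral_eq_lintegral_ofReal _ (ae_of_all _ (vandermondeSq_nonneg n))]
  · simp_rw [h1]
    rw [integral_const_mul, integral_slater_sq he (hμ.integral_orthoFun_mul hn)]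
  · exact hi.congr (ae_of_all _ fun x => (h1 x).symm)

lemma HasFiniteMoments.isProbabilityMeasure_ope (hμ : HasFiniteMoments μ) {n : ℕ}
    (hn : (n : ℕ∞) ≤ μ.support.encard) : IsProbabilityMeasure (ope μ n) := by
  have hpos : 0 < ∏ i : Fin n, orthoNormSq μ i :=
    Finset.prod_pos fun i _ => hμ.orthoNormSq_pos_of_lt hn i i.2
  constructor
  rw [ope, Measure.smul_apply, withDensity_apply _ MeasurableSet.univ, Measure.restrict_univ]
  change (opeZ μ n)⁻¹ * opeZ μ n = 1
  rw [hμ.opeZ_eq hn]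
  refine ENNReal.inv_mul_cancel ?_ ENNReal.ofReal_ne_top
  rw [Ne, ENNReal.ofReal_eq_zero, not_le]
  positivity

/-- Expectations under the ensemble in terms of the Slater determinant. -/
lemma HasFiniteMoments.integral_ope (hμ : HasFiniteMoments μ) {n : ℕ}
    (hn : (n : ℕ∞) ≤ μ.support.encard) (F : (Fin n → ℝ) → ℝ) :
    ∫ x, F x ∂(ope μ n) = (n.factorial : ℝ)⁻¹ *
      ∫ x, F x * (slaterMatrix (orthoFun μ n) x).det ^ 2 ∂(Measure.pi fun _ => μ) := by
  have hpos : 0 < ∏ i : Fin n, orthoNormSq μ i :=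
    Finset.prod_pos fun i _ => hμ.orthoNormSq_pos_of_lt hn i i.2
  rw [ope, integral_smul_measure, integral_withDensity_eq_integral_toReal_smul
    (measurable_ofReal_vandermondeSq n) (ae_of_all _ fun _ => ENNReal.ofReal_lt_top),
    hμ.opeZ_eq hn, ENNReal.toReal_inv, ENNReal.toReal_ofReal (by positivity)]
  have h1 : ∀ x, (ENNReal.ofReal (vandermondeSq n x)).toReal • F x =
      (∏ i : Fin n, orthoNormSq μ i) * (F x * (slaterMatrix (orthoFun μ n) x).det ^ 2) := by
    intro x
    rw [ENNReal.toReal_ofReal (vandermondeSq_nonneg n x),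
      vandermondeSq_eq μ (hμ.orthoNormSq_pos_of_lt hn), smul_eq_mul]
    ring
  simp_rw [h1]
  rw [integral_const_mul, smul_eq_mul]
  field_simp

omit [IsProbabilityMeasure μ] in
lemma HasFiniteMoments.memLp_mul_orthoFun (hμ : HasFiniteMoments μ) (n : ℕ) {f : ℝ → ℝ}
    (hf : Measurable f) {M : ℝ} (hM : ∀ x, |f x| ≤ M) (i : Fin n) :
    MemLp (fun x => f x * orthoFun μ n i x) 2 μ := by
  refine MemLp.of_le_mul (hμ.memLp_orthoFun n i) (c := M) ?_ (ae_of_all _ fun x => ?_)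
  · exact (hf.mul (orthoPoly μ i).continuous.measurable).aestronglyMeasurable
  · rw [norm_mul]
    gcongr
    exact hM x

lemma measurable_sum_apply {f : ℝ → ℝ} (hf : Measurable f) (n : ℕ) :
    Measurable fun x : Fin n → ℝ => ∑ j, f (x j) := by
  fun_prop

lemma abs_sum_apply_le {f : ℝ → ℝ} {M : ℝ} (hM : ∀ x, |f x| ≤ M) (n : ℕ) (x : Fin n → ℝ) :
    |∑ j, f (x j)| ≤ n * M := by
  refine (Finset.abs_sum_le_sum_abs _ _).trans ?_
  simpa using Finset.sum_le_sum fun j (_ : j ∈ (Finset.univ : Finset (Fin n))) => hM (x j)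

/-- The variance of a linear statistic is bounded by the defect of multiplication by `f` on the
polynomials of degree less than `n`. -/
lemma HasFiniteMoments.variance_ope_le (hμ : HasFiniteMoments μ) {n : ℕ}
    (hn : (n : ℕ∞) ≤ μ.support.encard) {f : ℝ → ℝ} (hf : Measurable f) {M : ℝ}
    (hM : ∀ x, |f x| ≤ M) :
    Var[fun x : Fin n → ℝ => ∑ j, f (x j); ope μ n] ≤ mulDefect μ f (orthoFun μ n) := by
  have := hμ.isProbabilityMeasure_ope hn
  have hm := measurable_sum_apply hf n
  rw [← variance_sub_const hm.aestronglyMeasurable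
    (∑ k, mulEntry μ f (orthoFun μ n) k k)]
  refine (variance_le_expectation_sq (hm.sub_const _).aestronglyMeasurable).trans_eq ?_
  rw [hμ.integral_ope hn]
  simp only [Pi.pow_apply]
  rw [(integral_linear_statistic_mul_slater_sq (hμ.memLp_orthoFun n)
    (hμ.integral_orthoFun_mul hn) (hμ.memLp_mul_orthoFun n hf hM)).2,
    inv_mul_cancel_left₀ (by positivity)]

lemma HasFiniteMoments.variance_ope_le_mul_sq (hμ : HasFiniteMoments μ) {n : ℕ}
    (hn : (n : ℕ∞) ≤ μ.support.encard) {f : ℝ → ℝ} (hf : Measurable f) {M : ℝ}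
    (hM : ∀ x, |f x| ≤ M) :
    Var[fun x : Fin n → ℝ => ∑ j, f (x j); ope μ n] ≤ n * M ^ 2 := by
  have he := hμ.memLp_orthoFun n
  have ho := hμ.integral_orthoFun_mul hn
  have hfe := hμ.memLp_mul_orthoFun n hf hM
  refine (hμ.variance_ope_le hn hf hM).trans ((mulDefect_le_sum_integral_sq he ho hfe).trans ?_)
  have h1 : ∀ k, ∫ x, (f x * orthoFun μ n k x) ^ 2 ∂μ ≤ M ^ 2 := by
    intro k
    have h2 : ∫ x, M ^ 2 * (orthoFun μ n k x) ^ 2 ∂μ = M ^ 2 := by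
      have h3 := ho k k
      simp_rw [← sq] at h3
      rw [integral_const_mul, h3]
      simp
    rw [← h2]
    refine integral_mono (hfe k).integrable_sq ((he k).integrable_sq.const_mul _) fun x => ?_
    have := pow_le_pow_left₀ (abs_nonneg _) (hM x) 2
    rw [sq_abs] at this
    change _ ≤ M ^ 2 * _
    rw [mul_pow]
    gcongr
  simpa using Finset.sum_le_sum fun k (_ : k ∈ (Finset.univ : Finset (Fin n))) => h1 k

/-- Comparison of `f` with the identity multiplier, which is unbounded but admissible because all
moments are finite. -/
lemma HasFiniteMoments.variance_ope_le_lipschitz (hμ : HasFiniteMoments μ) {n : ℕ} (hn1 : 1 ≤ n)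
    (hn : (n : ℕ∞) ≤ μ.support.encard) {f : ℝ → ℝ} (hf : Measurable f) {M : ℝ}
    (hM : ∀ x, |f x| ≤ M) {L : ℝ} (hL : ∀ x y, |f x - f y| ≤ L * |x - y|) :
    Var[fun x : Fin n → ℝ => ∑ j, f (x j); ope μ n] ≤
      L ^ 2 * (orthoNormSq μ n / orthoNormSq μ (n - 1)) := by
  have hx : ∀ i, MemLp (fun x => x * orthoFun μ n i x) 2 μ := fun i =>
    (hμ.memLp_eval (X * orthoPoly μ i)).congr_norm
      (measurable_id.mul (orthoPoly μ i).continuous.measurable).aestronglyMeasurable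
      (ae_of_all _ fun x => by simp [orthoFun])
  refine (hμ.variance_ope_le hn hf hM).trans ((mulDefect_le_of_abs_sub_le (hμ.memLp_orthoFun n)
    (hμ.integral_orthoFun_mul hn) (hμ.memLp_mul_orthoFun n hf hM) hx hL).trans ?_)
  gcongr
  exact hμ.mulDefect_id_le hn1 hn

/-! ### Stability of ensembles under tilting, and concentration -/

section Tilt

variable {f : ℝ → ℝ} (hf : Measurable f) {M : ℝ} (hM : ∀ x, |f x| ≤ M)

include hf hM

lemma isProbabilityMeasure_tilted_of_abs_le (u : ℝ) :
    IsProbabilityMeasure (μ.tilted fun x => u * f x) :=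
  isProbabilityMeasure_tilted (integrable_exp_mul_of_abs_le hf hM u)

omit hf [IsProbabilityMeasure μ] in
lemma exp_mul_mem_Icc (u x : ℝ) :
    Real.exp (-(|u| * M)) ≤ Real.exp (u * f x) ∧ Real.exp (u * f x) ≤ Real.exp (|u| * M) := by
  have h1 : |u * f x| ≤ |u| * M := by
    rw [abs_mul]
    gcongr
    exact hM x
  exact ⟨Real.exp_le_exp.2 (abs_le.1 h1).1, Real.exp_le_exp.2 (abs_le.1 h1).2⟩

lemma HasFiniteMoments.tilted (hμ : HasFiniteMoments μ) (u : ℝ) :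
    HasFiniteMoments (μ.tilted fun x => u * f x) := by
  intro k
  rw [integrable_tilted_iff (integrable_exp_mul_of_abs_le hf hM u)]
  refine (hμ k).bdd_mul (c := Real.exp (|u| * M)) (by fun_prop) (ae_of_all _ fun x => ?_)
  rw [Real.norm_of_nonneg (Real.exp_pos _).le]
  exact (exp_mul_mem_Icc hM u x).2

lemma support_subset_support_tilted (u : ℝ) :
    μ.support ⊆ (μ.tilted fun x => u * f x).support :=
  (absolutelyContinuous_tilted (integrable_exp_mul_of_abs_le hf hM u)).support_mono

/-- Exponentially tilting an ensemble by a linear statistic tilts the underlying measure. -/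
lemma HasFiniteMoments.ope_tilted (hμ : HasFiniteMoments μ) {n : ℕ}
    (hn : (n : ℕ∞) ≤ μ.support.encard) (u : ℝ) :
    (ope μ n).tilted (fun x => u * ∑ j, f (x j)) = ope (μ.tilted fun x => u * f x) n := by
  have hP := hμ.isProbabilityMeasure_ope hn
  have hν := isProbabilityMeasure_tilted_of_abs_le (μ := μ) hf hM u
  have hnν : (n : ℕ∞) ≤ (μ.tilted fun x => u * f x).support.encard :=
    hn.trans (Set.encard_le_encard (support_subset_support_tilted hf hM u))
  have hQ := (hμ.tilted hf hM u).isProbabilityMeasure_ope hnν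
  have hR : IsProbabilityMeasure ((ope μ n).tilted (fun x => u * ∑ j, f (x j))) :=
    isProbabilityMeasure_tilted
      (integrable_exp_mul_of_abs_le (measurable_sum_apply hf n) (abs_sum_apply_le hM n) u)
  set D : (Fin n → ℝ) → ℝ≥0∞ := fun x => ENNReal.ofReal (vandermondeSq n x) with hD
  have hDm : Measurable D := measurable_ofReal_vandermondeSq n
  set W : (Fin n → ℝ) → ℝ≥0∞ := fun x => ENNReal.ofReal (Real.exp (u * ∑ j, f (x j))) with hW
  have hWm : Measurable W :=
    ((measurable_sum_apply hf n).const_mul u).exp.ennreal_ofReal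
  set π : Measure (Fin n → ℝ) := Measure.pi fun _ => μ with hπ
  -- Both measures turn out to be multiples of the product measure with density `D * W`, because the
  -- exponential of a sum factors over the particles.
  obtain ⟨a, ha⟩ : ∃ a : ℝ≥0∞, (ope μ n).tilted (fun x => u * ∑ j, f (x j)) =
      a • (π.withDensity (D * W)) := by
    set c := ∫ x, Real.exp (u * ∑ j, f (x j)) ∂(ope μ n) with hc
    refine ⟨(opeZ μ n)⁻¹ * ENNReal.ofReal c⁻¹, ?_⟩
    have h1 : (fun x : Fin n → ℝ => ENNReal.ofReal (Real.exp (u * ∑ j, f (x j)) / c)) =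
        ENNReal.ofReal c⁻¹ • W := by
      funext x
      rw [div_eq_mul_inv, mul_comm, ENNReal.ofReal_mul' (Real.exp_pos _).le]
      rfl
    rw [Measure.tilted, ← hc, h1, withDensity_smul _ hWm, ope, withDensity_smul_measure,
      ← withDensity_mul _ hDm hWm, smul_smul, mul_comm]
  obtain ⟨b, hb⟩ : ∃ b : ℝ≥0∞, ope (μ.tilted fun x => u * f x) n =
      b • (π.withDensity (D * W)) := by
    set c := ∫ x, Real.exp (u * f x) ∂μ with hc
    have h1 : μ.tilted (fun x => u * f x) =
        μ.withDensity fun x => ENNReal.ofReal (Real.exp (u * f x) / c) := rfl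
    have hwm : Measurable fun x => ENNReal.ofReal (Real.exp (u * f x) / c) :=
      ((hf.const_mul u).exp.div_const c).ennreal_ofReal
    have h2 : (fun x : Fin n → ℝ => ∏ i, ENNReal.ofReal (Real.exp (u * f (x i)) / c)) =
        ENNReal.ofReal c⁻¹ ^ n • W := by
      funext x
      have h3 : ∀ i, ENNReal.ofReal (Real.exp (u * f (x i)) / c) =
          ENNReal.ofReal c⁻¹ * ENNReal.ofReal (Real.exp (u * f (x i))) := fun i => by
        rw [div_eq_mul_inv, mul_comm, ENNReal.ofReal_mul' (Real.exp_pos _).le]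
      simp_rw [h3, Finset.prod_mul_distrib]
      rw [← ENNReal.ofReal_prod_of_nonneg fun i _ => (Real.exp_pos _).le, ← Real.exp_sum,
        ← Finset.mul_sum]
      simp [hW]
    have h4 : Measure.pi (fun _ : Fin n => μ.tilted fun x => u * f x) =
        ENNReal.ofReal c⁻¹ ^ n • π.withDensity W := by
      rw [h1] at hν ⊢
      rw [pi_withDensity_const hwm, h2, withDensity_smul _ hWm]
    refine ⟨(opeZ (μ.tilted fun x => u * f x) n)⁻¹ * ENNReal.ofReal c⁻¹ ^ n, ?_⟩
    rw [ope, h4, withDensity_smul_measure, ← withDensity_mul _ hWm hDm, smul_smul, mul_comm W D]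
  rw [ha] at hR ⊢
  rw [hb] at hQ ⊢
  exact smul_eq_smul_of_isProbabilityMeasure hR hQ

/-- A bounded tilt changes the ratio of consecutive norms by a bounded factor. -/
lemma HasFiniteMoments.orthoNormSq_ratio_tilted_le (hμ : HasFiniteMoments μ) {n : ℕ}
    (hn : (n : ℕ∞) < μ.support.encard) (u : ℝ) :
    orthoNormSq (μ.tilted fun x => u * f x) n / orthoNormSq (μ.tilted fun x => u * f x) (n - 1) ≤
      Real.exp (2 * (|u| * M)) * (orthoNormSq μ n / orthoNormSq μ (n - 1)) := by
  set ν := μ.tilted fun x => u * f x with hν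
  have hνm := hμ.tilted hf hM u
  have hnν : (n : ℕ∞) < ν.support.encard :=
    hn.trans_le (Set.encard_le_encard (support_subset_support_tilted hf hM u))
  have hpred : ((n - 1 : ℕ) : ℕ∞) ≤ n := Nat.cast_le.2 (Nat.sub_le n 1)
  have hint := integrable_exp_mul_of_abs_le (P := μ) hf hM u
  set c := ∫ x, Real.exp (u * f x) ∂μ with hc
  have hc0 : 0 < c := integral_exp_pos hint
  have hform : ∀ p : ℝ[X], polyInner ν p p =
      c⁻¹ * ∫ x, Real.exp (u * f x) * (p.eval x * p.eval x) ∂μ := by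
    intro p
    rw [polyInner, hν, integral_tilted, ← hc, ← integral_const_mul]
    congr 1
    funext x
    rw [smul_eq_mul]; ring
  have hintp : ∀ p : ℝ[X], Integrable (fun x => Real.exp (u * f x) * (p.eval x * p.eval x)) μ := by
    intro p
    refine (hμ.integrable_eval_mul p p).bdd_mul (c := Real.exp (|u| * M)) (by fun_prop)
      (ae_of_all _ fun x => ?_)
    rw [Real.norm_of_nonneg (Real.exp_pos _).le]
    exact (exp_mul_mem_Icc hM u x).2
  -- Extremality for `ν`, tested on the monic orthogonal polynomial of `μ`; the bound `hlow`
  -- reverses the roles in degree `n - 1`. The normalization `c` cancels in the quotient.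
  have hup : orthoNormSq ν n ≤ c⁻¹ * (Real.exp (|u| * M) * orthoNormSq μ n) := by
    refine (hνm.orthoNormSq_le hnν.le (monic_monicOrthoPoly μ n)
      (natDegree_monicOrthoPoly μ n)).trans ?_
    rw [hform, orthoNormSq, polyInner, ← integral_const_mul (Real.exp (|u| * M))]
    refine mul_le_mul_of_nonneg_left ?_ (inv_nonneg.2 hc0.le)
    refine integral_mono (hintp _) ((hμ.integrable_eval_mul _ _).const_mul _) fun x => ?_
    exact mul_le_mul_of_nonneg_right (exp_mul_mem_Icc hM u x).2 (mul_self_nonneg _)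
  have hlow : c⁻¹ * (Real.exp (-(|u| * M)) * orthoNormSq μ (n - 1)) ≤ orthoNormSq ν (n - 1) := by
    refine le_trans ?_ (hform _).ge
    gcongr
    refine (mul_le_mul_of_nonneg_left (hμ.orthoNormSq_le (hpred.trans hn.le)
      (monic_monicOrthoPoly ν (n - 1)) (natDegree_monicOrthoPoly ν (n - 1)))
      (Real.exp_pos _).le).trans ?_
    rw [polyInner, ← integral_const_mul]
    refine integral_mono ((hμ.integrable_eval_mul _ _).const_mul _) (hintp _) fun x => ?_
    exact mul_le_mul_of_nonneg_right (exp_mul_mem_Icc hM u x).1 (mul_self_nonneg _)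
  have h0 : 0 < orthoNormSq μ (n - 1) := hμ.orthoNormSq_pos (hpred.trans_lt hn)
  have h0n : 0 < orthoNormSq μ n := hμ.orthoNormSq_pos hn
  calc _ ≤ c⁻¹ * (Real.exp (|u| * M) * orthoNormSq μ n) /
        (c⁻¹ * (Real.exp (-(|u| * M)) * orthoNormSq μ (n - 1))) :=
        div_le_div₀ (by positivity) hup (by positivity) hlow
    _ = _ := by
      rw [two_mul, Real.exp_add, Real.exp_neg]
      field_simp

/-- Concentration of linear statistics of bounded functions. -/
lemma HasFiniteMoments.measureReal_ope_bounded_le (hμ : HasFiniteMoments μ) {n : ℕ} (hn1 : 1 ≤ n)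
    (hn : (n : ℕ∞) ≤ μ.support.encard) (hM0 : 0 < M) {δ : ℝ} (hδ : 0 < δ) :
    (ope μ n).real {x | δ ≤ |∑ j, f (x j) - ∫ y, ∑ j, f (y j) ∂(ope μ n)|} ≤
      2 * Real.exp (-min (δ ^ 2 / (4 * (n * M ^ 2))) (δ * (1 / (3 * M)) / 2)) := by
  have := hμ.isProbabilityMeasure_ope hn
  have hn0 : (0 : ℝ) < n := by exact_mod_cast hn1
  -- The variance bound holds for every tilt, so the range `|u| ≤ 1 / (3 * M)` serves only to match
  -- the Lipschitz case.
  refine measureReal_abs_ge_le_of_variance_tilted_le (measurable_sum_apply hf n)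
    (abs_sum_apply_le hM n) (by positivity) (by positivity) hδ fun u _ => ?_
  have := isProbabilityMeasure_tilted_of_abs_le (μ := μ) hf hM u
  rw [hμ.ope_tilted hf hM hn u]
  have h1 := (hμ.tilted hf hM u).variance_ope_le_mul_sq
    (hn.trans (Set.encard_le_encard (support_subset_support_tilted hf hM u))) hf hM
  have : 0 ≤ n * M ^ 2 := by positivity
  linarith

/-- Concentration of linear statistics of bounded Lipschitz functions. -/
lemma HasFiniteMoments.measureReal_ope_lipschitz_le (hμ : HasFiniteMoments μ) {n : ℕ}
    (hn1 : 1 ≤ n) (hn : (n : ℕ∞) < μ.support.encard) (hM0 : 0 < M) {L B : ℝ} (hL0 : 0 < L)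
    (hL : ∀ x y, |f x - f y| ≤ L * |x - y|) (hB0 : 0 < B)
    (hB : orthoNormSq μ n / orthoNormSq μ (n - 1) ≤ B) {δ : ℝ} (hδ : 0 < δ) :
    (ope μ n).real {x | δ ≤ |∑ j, f (x j) - ∫ y, ∑ j, f (y j) ∂(ope μ n)|} ≤
      2 * Real.exp (-min (δ ^ 2 / (4 * (L ^ 2 * B))) (δ * (1 / (3 * M)) / 2)) := by
  have := hμ.isProbabilityMeasure_ope hn.le
  refine measureReal_abs_ge_le_of_variance_tilted_le (measurable_sum_apply hf n)
    (abs_sum_apply_le hM n) (by positivity) (by positivity) hδ fun u hu => ?_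
  have := isProbabilityMeasure_tilted_of_abs_le (μ := μ) hf hM u
  rw [hμ.ope_tilted hf hM hn.le u]
  have h1 := (hμ.tilted hf hM u).variance_ope_le_lipschitz hn1
    (hn.le.trans (Set.encard_le_encard (support_subset_support_tilted hf hM u))) hf hM hL
  have h2 := hμ.orthoNormSq_ratio_tilted_le hf hM hn u
  have h3 : Real.exp (2 * (|u| * M)) ≤ 2 := by
    have h4 : |u| * M ≤ 1 / 3 := by
      calc |u| * M ≤ 1 / (3 * M) * M := by gcongr
        _ = 1 / 3 := by field_simp
    have h5 : Real.exp (2 * (|u| * M)) ≤ Real.exp (2 / 3) := Real.exp_le_exp.2 (by linarith)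
    -- Amounts to `e² < 8`.
    have h6 : Real.exp (2 / 3) ^ 3 ≤ 2 ^ 3 := by
      rw [← Real.exp_nat_mul]
      have : Real.exp ((3 : ℕ) * (2 / 3)) = Real.exp 1 ^ 2 := by
        rw [← Real.exp_nat_mul]; norm_num
      rw [this]
      have := Real.exp_one_lt_d9
      have := Real.exp_pos 1
      nlinarith
    exact h5.trans (le_of_pow_le_pow_left₀ (by norm_num) (by norm_num) h6)
  have h7 : Real.exp (2 * (|u| * M)) * (orthoNormSq μ n / orthoNormSq μ (n - 1)) ≤ 2 * B :=
    mul_le_mul h3 hB (div_nonneg (polyInner_self_nonneg _) (polyInner_self_nonneg _)) zero_le_two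
  calc _ ≤ _ := h1
    _ ≤ L ^ 2 * (2 * B) := by gcongr; exact h2.trans h7
    _ = _ := by ring

end Tilt

end Ensemble

/-! ### Scaled linear statistics and the explicit bounds -/

section LinearStatistics

lemma abs_le_realSupNorm {f : ℝ → ℝ} (hb : ∃ M : ℝ, ∀ x, |f x| ≤ M) (x : ℝ) :
    |f x| ≤ realSupNorm f := by
  obtain ⟨M, hM⟩ := hb
  exact le_ciSup (f := fun x => |f x|) ⟨M, Set.forall_mem_range.2 hM⟩ x

lemma realSupNorm_nonneg (f : ℝ → ℝ) : 0 ≤ realSupNorm f :=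
  Real.iSup_nonneg fun _ => abs_nonneg _

lemma realSupNorm_pos {f : ℝ → ℝ} (hb : ∃ M : ℝ, ∀ x, |f x| ≤ M) (hf : ∃ x, f x ≠ 0) :
    0 < realSupNorm f := by
  obtain ⟨x, hx⟩ := hf
  exact (abs_pos.2 hx).trans_le (abs_le_realSupNorm hb x)

lemma tendsto_exp_bound_iff {α ε A M : ℝ} (hα1 : α < 1) (hε : 0 < ε) (hA : 0 < A) (hM : 0 < M) :
    Tendsto (fun n : ℕ => 2 * Real.exp (-(ε * min (ε * (n : ℝ) ^ (1 - 2 * α) / (8 * A * M ^ 2))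
      ((n : ℝ) ^ (1 - α) / (6 * M))))) atTop (𝓝 0) ↔ α < 1 / 2 := by
  constructor
  · intro h
    by_contra! hα
    -- For `α ≥ 1/2` the power `n ^ (1 - 2α)` is at most `1`, so the bound stays above a fixed
    -- positive number.
    have hle : 2 * Real.exp (-(ε * (ε / (8 * A * M ^ 2)))) ≤ 0 := by
      refine ge_of_tendsto h ?_
      filter_upwards [eventually_ge_atTop 1] with n hn
      have h1 : (n : ℝ) ^ (1 - 2 * α) ≤ 1 :=
        Real.rpow_le_one_of_one_le_of_nonpos (by exact_mod_cast hn) (by linarith)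
      have h2 : min (ε * (n : ℝ) ^ (1 - 2 * α) / (8 * A * M ^ 2)) ((n : ℝ) ^ (1 - α) / (6 * M)) ≤
          ε / (8 * A * M ^ 2) := by
        refine (min_le_left _ _).trans ?_
        gcongr
        nlinarith
      gcongr
    have := Real.exp_pos (-(ε * (ε / (8 * A * M ^ 2))))
    linarith
  · intro hα
    have h1 : Tendsto (fun n : ℕ => (n : ℝ) ^ (1 - 2 * α)) atTop atTop :=
      (tendsto_rpow_atTop (by linarith)).comp tendsto_natCast_atTop_atTop
    have h2 : Tendsto (fun n : ℕ => (n : ℝ) ^ (1 - α)) atTop atTop :=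
      (tendsto_rpow_atTop (by linarith)).comp tendsto_natCast_atTop_atTop
    have h3 : Tendsto (fun n : ℕ => ε * min (ε * (n : ℝ) ^ (1 - 2 * α) / (8 * A * M ^ 2))
        ((n : ℝ) ^ (1 - α) / (6 * M))) atTop atTop := by
      refine Tendsto.const_mul_atTop hε ?_
      refine tendsto_atTop.2 fun b => ?_
      filter_upwards [((h1.const_mul_atTop hε).atTop_div_const
        (r := 8 * A * M ^ 2) (by positivity)).eventually_ge_atTop b,
        (h2.atTop_div_const (r := 6 * M) (by positivity)).eventually_ge_atTop b] with n ha hb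
      exact le_min ha hb
    simpa using (Real.tendsto_exp_neg_atTop_nhds_zero.comp h3).const_mul 2

lemma HasFiniteMoments.linStat_bounded_deviation_le {μ : Measure ℝ} [IsProbabilityMeasure μ]
    (hμ : HasFiniteMoments μ) (xs α : ℝ) {f : ℝ → ℝ} (hf : Measurable f)
    (hb : ∃ M : ℝ, ∀ x, |f x| ≤ M) {ε : ℝ} (hε : 0 < ε) {N : ℝ} (hN : N ≠ 0) {n : ℕ}
    (hn1 : 1 ≤ n) (hn : (n : ℕ∞) ≤ μ.support.encard) :
    (ope μ n).real {x | 1 / N * linStatDev μ f α xs n x ≥ ε} ≤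
      2 * Real.exp (-(ε * min (ε * N ^ 2 / (8 * (1 / 2) * n * realSupNorm f ^ 2))
        (N / (6 * realSupNorm f)))) := by
  have := hμ.isProbabilityMeasure_ope hn
  have hn0 : (0 : ℝ) < n := by exact_mod_cast hn1
  rcases (realSupNorm_nonneg f).eq_or_lt with hM | hM
  -- With `f = 0`, division by zero makes the minimum `0`, and the asserted bound is the trivial
  -- `2`.
  · rw [← hM]
    have : (ope μ n).real {x | 1 / N * linStatDev μ f α xs n x ≥ ε} ≤ 1 := measureReal_le_one
    exact this.trans (by simp)
  rcases lt_or_gt_of_ne hN with hN | hN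
  -- For negative `N` the event is empty, whatever the sign of the exponent.
  · have h0 : {x | 1 / N * linStatDev μ f α xs n x ≥ ε} = ∅ := by
      refine Set.eq_empty_of_forall_notMem fun x hx => ?_
      have h1 : 1 / N * linStatDev μ f α xs n x ≤ 0 :=
        mul_nonpos_of_nonpos_of_nonneg (one_div_nonpos.2 hN.le) (abs_nonneg _)
      have hx' : ε ≤ 1 / N * linStatDev μ f α xs n x := hx
      linarith
    rw [h0, measureReal_empty]
    positivity
  · have h0 : {x | 1 / N * linStatDev μ f α xs n x ≥ ε} =
        {x | ε * N ≤ linStatDev μ f α xs n x} := by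
      ext x
      simp only [Set.mem_ofPred_eq, ge_iff_le, one_div_mul_eq_div, le_div_iff₀ hN]
    rw [h0]
    refine (hμ.measureReal_ope_bounded_le (f := fun x => f ((n : ℝ) ^ α * (x - xs)))
      (by fun_prop) (fun x => abs_le_realSupNorm hb _) hn1 hn hM (mul_pos hε hN)).trans_eq ?_
    congr 3
    rw [mul_min_of_nonneg _ _ hε.le]
    congr 1
    · field_simp; norm_num
    · field_simp; norm_num

lemma HasFiniteMoments.linStat_lipschitz_deviation_le {μ : Measure ℝ} [IsProbabilityMeasure μ]
    (hμ : HasFiniteMoments μ) (xs α : ℝ) {f : ℝ → ℝ} {L : ℝ≥0} (hf : LipschitzWith L f)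
    (hb : ∃ M : ℝ, ∀ x, |f x| ≤ M) {ε : ℝ} (hε : 0 < ε) {n : ℕ}
    (hn1 : 1 ≤ n) (hn : (n : ℕ∞) < μ.support.encard) {B : ℝ} (hB0 : 0 < B)
    (hB : orthoNormSq μ n / orthoNormSq μ (n - 1) ≤ B) :
    (ope μ n).real {x | 1 / (n : ℝ) ^ α * linStatDev μ f α xs n x ≥ ε} ≤
      2 * Real.exp (-(ε * min (ε / (2 * (2 * B) * (L : ℝ) ^ 2))
        ((n : ℝ) ^ α / (6 * realSupNorm f)))) := by
  have := hμ.isProbabilityMeasure_ope hn.le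
  have hn0 : (0 : ℝ) < n := by exact_mod_cast hn1
  have hN : 0 < (n : ℝ) ^ α := Real.rpow_pos_of_pos hn0 α
  have hle1 : (ope μ n).real {x | 1 / (n : ℝ) ^ α * linStatDev μ f α xs n x ≥ ε} ≤ 1 :=
    measureReal_le_one
  rcases (realSupNorm_nonneg f).eq_or_lt with hM | hM
  · rw [← hM, mul_zero, div_zero, min_eq_right (by positivity)]
    exact hle1.trans (by simp)
  rcases (NNReal.coe_nonneg L).eq_or_lt with hL | hL
  · rw [← hL, zero_pow two_ne_zero, mul_zero, div_zero, min_eq_left (by positivity)]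
    exact hle1.trans (by simp)
  have h0 : {x | 1 / (n : ℝ) ^ α * linStatDev μ f α xs n x ≥ ε} =
      {x | ε * (n : ℝ) ^ α ≤ linStatDev μ f α xs n x} := by
    ext x
    simp only [Set.mem_ofPred_eq, ge_iff_le, one_div_mul_eq_div, le_div_iff₀ hN]
  have hLip : ∀ x y, |f ((n : ℝ) ^ α * (x - xs)) - f ((n : ℝ) ^ α * (y - xs))| ≤
      L * (n : ℝ) ^ α * |x - y| := by
    intro x y
    have h1 := hf.dist_le_mul ((n : ℝ) ^ α * (x - xs)) ((n : ℝ) ^ α * (y - xs))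
    rw [Real.dist_eq, Real.dist_eq, ← mul_sub, sub_sub_sub_cancel_right, abs_mul,
      abs_of_pos hN] at h1
    linarith
  rw [h0]
  have hfm := hf.continuous.measurable
  refine (hμ.measureReal_ope_lipschitz_le (f := fun x => f ((n : ℝ) ^ α * (x - xs)))
    (by fun_prop) (fun x => abs_le_realSupNorm hb _) hn1 hn hM (mul_pos hL hN) hLip hB0 hB
    (mul_pos hε hN)).trans_eq ?_
  congr 3
  rw [mul_min_of_nonneg _ _ hε.le]
  congr 1
  · field_simp; norm_num
  · field_simp; norm_num

/-- Multiplying the monic orthogonal polynomial of degree `n - 1` by `x` gives a monic competitor of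
degree `n`, and `x² ≤ R²` on the support. -/
lemma HasFiniteMoments.exists_orthoNormSq_ratio_le_of_isCompact {μ : Measure ℝ}
    (hμ : HasFiniteMoments μ) (hc : IsCompact μ.support)
    (hs : ∀ n : ℕ, (n : ℕ∞) < μ.support.encard) :
    ∃ B : ℝ, ∀ n : ℕ, 1 ≤ n → orthoNormSq μ n / orthoNormSq μ (n - 1) ≤ B := by
  obtain ⟨R, hR⟩ := hc.isBounded.exists_norm_le
  refine ⟨R ^ 2, fun n hn1 => ?_⟩
  rw [div_le_iff₀ (hμ.orthoNormSq_pos (hs _))]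
  obtain ⟨m, rfl⟩ : ∃ m, n = m + 1 := ⟨n - 1, by omega⟩
  rw [Nat.add_sub_cancel]
  refine (hμ.orthoNormSq_le (hs _).le (monic_X.mul (monic_monicOrthoPoly μ m)) ?_).trans ?_
  · rw [natDegree_X_mul (monic_monicOrthoPoly μ m).ne_zero, natDegree_monicOrthoPoly]
  rw [orthoNormSq, polyInner, polyInner, ← integral_const_mul]
  refine integral_mono_ae (hμ.integrable_eval_mul _ _) ((hμ.integrable_eval_mul _ _).const_mul _) ?_
  filter_upwards [Measure.support_mem_ae (μ := μ)] with x hx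
  have h1 : x ^ 2 ≤ R ^ 2 := by
    have := pow_le_pow_left₀ (norm_nonneg x) (hR x hx) 2
    rwa [Real.norm_eq_abs, sq_abs] at this
  have h2 := mul_le_mul_of_nonneg_right h1 (mul_self_nonneg ((monicOrthoPoly μ m).eval x))
  simp only [eval_mul, eval_X]
  linarith

end LinearStatistics

/-! ### Assembly with explicit constants -/

theorem mainTheorem5 :
    -- Part I: one universal constant `A`
    (∃ A : ℝ, 0 < A ∧
      ∀ (μ : Measure ℝ) [IsProbabilityMeasure μ], HasFiniteMoments μ →
      ∀ (xs α : ℝ), 0 < α →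
      ∀ f : ℝ → ℝ, Measurable f → (∃ M : ℝ, ∀ x, |f x| ≤ M) →
      ∀ ε : ℝ, 0 < ε →
        -- an arbitrary normalization `N`
        (∀ N : ℝ, N ≠ 0 → ∀ n : ℕ, 1 ≤ n → (n : ℕ∞) ≤ μ.support.encard →
          (ope μ n).real {x | 1 / N * linStatDev μ f α xs n x ≥ ε} ≤
            2 * Real.exp (-(ε * min (ε * N ^ 2 / (8 * A * n * realSupNorm f ^ 2))
              (N / (6 * realSupNorm f))))) ∧
        -- the normalization `N = n ^ (1 - α)`
        (α < 1 → ∀ n : ℕ, 1 ≤ n → (n : ℕ∞) ≤ μ.support.encard →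
          (ope μ n).real {x | 1 / (n : ℝ) ^ (1 - α) * linStatDev μ f α xs n x ≥ ε} ≤
            2 * Real.exp (-(ε * min (ε * (n : ℝ) ^ (1 - 2 * α) / (8 * A * realSupNorm f ^ 2))
              ((n : ℝ) ^ (1 - α) / (6 * realSupNorm f))))) ∧
        -- for which the bound tends to `0` exactly when `α < 1 / 2`
        (α < 1 → (∃ x, f x ≠ 0) →
          (Tendsto (fun n : ℕ =>
            2 * Real.exp (-(ε * min (ε * (n : ℝ) ^ (1 - 2 * α) / (8 * A * realSupNorm f ^ 2))
              ((n : ℝ) ^ (1 - α) / (6 * realSupNorm f))))) atTop (𝓝 0) ↔ α < 1 / 2))) ∧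
    -- Part II: Lipschitz functions, with a constant `A` that depends on the measures only
    (∀ (μ : ℕ → Measure ℝ) [∀ n, IsProbabilityMeasure (μ n)],
      (∀ n, HasFiniteMoments (μ n)) →
      (∀ n : ℕ, (n : ℕ∞) < (μ n).support.encard) →
      ((∃ μ₀ : Measure ℝ, IsCompact μ₀.support ∧ ∀ n, μ n = μ₀) ∨
        (fun n : ℕ => (orthoLead (μ n) (n - 1) / orthoLead (μ n) n) ^ 2)
          =O[atTop] (fun _ : ℕ => (1 : ℝ))) →
      ∃ A : ℝ, 0 < A ∧
        ∀ (xs α : ℝ), 0 < α →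
        ∀ (f : ℝ → ℝ) (L : ℝ≥0), LipschitzWith L f → (∃ M : ℝ, ∀ x, |f x| ≤ M) →
        ∀ ε : ℝ, 0 < ε →
          (∀ n : ℕ, 1 ≤ n →
            (ope (μ n) n).real {x | 1 / (n : ℝ) ^ α * linStatDev (μ n) f α xs n x ≥ ε} ≤
              2 * Real.exp (-(ε * min (ε / (2 * A * (L : ℝ) ^ 2))
                ((n : ℝ) ^ α / (6 * realSupNorm f))))) ∧
          (∀ᶠ n : ℕ in atTop,
            (ope (μ n) n).real {x | 1 / (n : ℝ) ^ α * linStatDev (μ n) f α xs n x ≥ ε} ≤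
              2 * Real.exp (-(ε ^ 2 / (2 * A * (L : ℝ) ^ 2))))) := by
  constructor
  -- `A = 1/2` turns `8 A n ‖f‖²` into `4V` with `V = n ‖f‖²`.
  · refine ⟨1 / 2, by norm_num, ?_⟩
    intro μ _ hμ xs α _ f hf hb ε hε
    refine ⟨fun N hN n hn1 hn => hμ.linStat_bounded_deviation_le xs α hf hb hε hN hn1 hn, ?_, ?_⟩
    · intro _ n hn1 hn
      have hn0 : (0 : ℝ) < n := by exact_mod_cast hn1
      have h1 : ((n : ℝ) ^ (1 - α)) ^ 2 = (n : ℝ) ^ (1 - 2 * α) * n := by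
        rw [← Real.rpow_natCast, ← Real.rpow_mul hn0.le, ← Real.rpow_add_one hn0.ne']
        congr 1
        push_cast
        ring
      refine (hμ.linStat_bounded_deviation_le xs α hf hb hε
        (Real.rpow_pos_of_pos hn0 (1 - α)).ne' hn1 hn).trans_eq ?_
      have h2 : ε * (((n : ℝ) ^ (1 - α)) ^ 2) / (8 * (1 / 2) * n * realSupNorm f ^ 2) =
          ε * (n : ℝ) ^ (1 - 2 * α) / (8 * (1 / 2) * realSupNorm f ^ 2) := by
        rw [h1, ← mul_assoc, mul_right_comm _ (n : ℝ), mul_div_mul_right _ _ hn0.ne']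
      rw [h2]
    · intro hα1 hf0
      exact tendsto_exp_bound_iff hα1 hε (by norm_num) (realSupNorm_pos hb hf0)
  · intro μ _ hμ hs hbound
    obtain ⟨B₀, hB₀⟩ : ∃ B : ℝ, ∀ n : ℕ, 1 ≤ n →
        orthoNormSq (μ n) n / orthoNormSq (μ n) (n - 1) ≤ B := by
      rcases hbound with ⟨μ₀, hc, he⟩ | hO
      · simp_rw [he] at hs ⊢
        exact (he 0 ▸ hμ 0).exists_orthoNormSq_ratio_le_of_isCompact hc hs
      -- Along the natural numbers, boundedness at infinity is boundedness of the whole sequence, so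
      -- no initial `n` is lost.
      · obtain ⟨c, hc⟩ := isBigO_one_nat_atTop_iff.1 hO
        refine ⟨c, fun n _ => ?_⟩
        rw [← (hμ n).orthoLead_div_sq (hs n)]
        exact (le_abs_self _).trans (hc n)
    set B := max B₀ 1 with hBdef
    have hB0 : 0 < B := zero_lt_one.trans_le (le_max_right _ _)
    -- After the scaling `n^α` cancels, the Chernoff denominator is `4 B L²`, which is `2 A L²` for
    -- `A = 2B`.
    refine ⟨2 * B, by positivity, ?_⟩
    intro xs α hα f L hf hb ε hε
    have main : ∀ n : ℕ, 1 ≤ n →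
        (ope (μ n) n).real {x | 1 / (n : ℝ) ^ α * linStatDev (μ n) f α xs n x ≥ ε} ≤
          2 * Real.exp (-(ε * min (ε / (2 * (2 * B) * (L : ℝ) ^ 2))
            ((n : ℝ) ^ α / (6 * realSupNorm f)))) := fun n hn1 =>
      (hμ n).linStat_lipschitz_deviation_le xs α hf hb hε hn1 (hs n) hB0
        ((hB₀ n hn1).trans (le_max_left _ _))
    refine ⟨main, ?_⟩
    by_cases hf0 : ∃ x, f x ≠ 0
    · have hM := realSupNorm_pos hb hf0
      have h1 : Tendsto (fun n : ℕ => (n : ℝ) ^ α / (6 * realSupNorm f)) atTop atTop :=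
        ((tendsto_rpow_atTop hα).comp tendsto_natCast_atTop_atTop).atTop_div_const
          (by positivity)
      -- Once `n ^ α / (6 ‖f‖)` exceeds the constant first term, the minimum is that term.
      filter_upwards [eventually_ge_atTop 1,
        h1.eventually_ge_atTop (ε / (2 * (2 * B) * (L : ℝ) ^ 2))] with n hn1 hn2
      refine (main n hn1).trans_eq ?_
      rw [min_eq_left hn2, ← mul_div_assoc, ← sq]
    -- For `f = 0` the general bound degenerates to `2`, so the eventual bound needs its own
    -- argument: the deviation is identically zero.
    · push Not at hf0
      refine Eventually.of_forall fun n => ?_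
      have h0 : {x | 1 / (n : ℝ) ^ α * linStatDev (μ n) f α xs n x ≥ ε} = ∅ := by
        refine Set.eq_empty_of_forall_notMem fun x hx => ?_
        have hx' : ε ≤ 1 / (n : ℝ) ^ α * linStatDev (μ n) f α xs n x := hx
        simp [linStatDev, linStat, hf0] at hx'
        linarith
      rw [h0, measureReal_empty]
      positivity
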